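/- Let $Y$ and $S$ be complex algebraic varieties (integral separated schemes of finite type over $\mathbb{C}$) with $Y$ nonsingular, and let $\pi:Y\to S$ be a proper birational morphism over $\mathbb{C}$. For $d\ge 0$ let $Y_d\subseteq Y$ be the locus where the differential of $\pi$ has rank $d$, and assume that $\pi$ is *trim*, i.e. $\dim Y_d<d$ for all $0\le d<\dim Y$ (where $\dim\emptyset=-\infty$). Then $\pi$ is *small*. That is, $\pi$ is proper and surjective, $\dim Y=\dim S$, and $$2\,d(Z)<\operatorname{codim}_S Z=\dim S-\dim Z$$ for every proper (i.e. non-dense) stratum $Z$ of every finite stratification of $S$ adapted to $\pi$; here the strata are nonempty locally closed subsets partitioning $S$, *adapted* means that the fibers of $\pi$ over the closed points of each stratum $Z$ all have the same dimension, and $d(Z)$ denotes this common dimension. More generally, the inequality holds for every nonempty non-dense locally closed subset $Z\subseteq S$ such that the fibers of $\pi$ over the closed points of $Z$ all have the same dimension $d(Z)$. -/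

import Mathlib

open CategoryTheory AlgebraicGeometry

namespace TrimMaps

/-- The base scheme `Spec ℂ`. -/
noncomputable abbrev SpecC : Scheme.{0} := Spec (CommRingCat.of ℂ)

/-- A complex algebraic variety: an integral separated scheme of finite type over `ℂ`. -/
class IsVariety (X : Scheme.{0}) [X.Over SpecC] : Prop where
  isIntegral : IsIntegral X
  isSeparated : IsSeparated (X ↘ SpecC)
  locallyOfFiniteType : LocallyOfFiniteType (X ↘ SpecC)
  quasiCompact : QuasiCompact (X ↘ SpecC)

/-- A variety is nonsingular if it is smooth over `ℂ`. -/
def IsNonsingular (X : Scheme.{0}) [X.Over SpecC] : Prop :=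
  Smooth (X ↘ SpecC)

/-- A morphism is birational if it restricts to an isomorphism from a dense open subscheme of the
source onto a dense open subscheme of the target. -/
def IsBirational {Y S : Scheme.{0}} (π : Y ⟶ S) : Prop :=
  ∃ f : Scheme.PartialIso Y S, f.iso.hom ≫ f.target.ι = f.source.ι ≫ π

section Differential

/-- The structure map `ℂ → 𝒪_{X,x}` of a scheme over `ℂ`. -/
noncomputable def stalkStructureHom (X : Scheme.{0}) [X.Over SpecC] (x : X) :
    ℂ →+* X.presheaf.stalk x :=
  ((Scheme.ΓSpecIso (CommRingCat.of ℂ)).inv ≫ (X ↘ SpecC).appTop ≫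
    X.presheaf.germ ⊤ x trivial).hom

theorem stalkMap_comp_stalkStructureHom {Y S : Scheme.{0}} [Y.Over SpecC] [S.Over SpecC]
    (π : Y ⟶ S) [π.IsOver SpecC] (y : Y) :
    (π.stalkMap y).hom.comp (stalkStructureHom S (π y)) = stalkStructureHom Y y := by
  have h : (Y ↘ SpecC).appTop = (S ↘ SpecC).appTop ≫ π.appTop := by
    rw [← Scheme.Hom.comp_appTop, comp_over π SpecC]
  have h' : S.presheaf.germ ⊤ (π y) trivial ≫ π.stalkMap y =
      π.appTop ≫ Y.presheaf.germ ⊤ y trivial := Scheme.Hom.germ_stalkMap π ⊤ y trivial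
  unfold stalkStructureHom
  rw [h, ← CommRingCat.hom_comp]
  simp only [Category.assoc, h']

/-- For ring homomorphisms `A → B → K` over `k`, with `K` a field, precomposition with `A → B`
as a `K`-linear map `Der_k(B, K) → Der_k(A, K)`. -/
noncomputable def derivationPullback (k A B K : Type) [CommRing k] [CommRing A] [CommRing B]
    [Field K] [Algebra k A] [Algebra k B] [Algebra A B] [Algebra k K] [Algebra A K] [Algebra B K]
    [IsScalarTower k A B] [IsScalarTower k A K] [IsScalarTower k B K] [IsScalarTower A B K] :
    Derivation k B K →ₗ[K] Derivation k A K where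
  toFun D := D.compAlgebraMap A
  map_add' _ _ := rfl
  map_smul' _ _ := rfl

/-- The rank at `y` of the differential `dπ : T_y Y → T_{π(y)} S`, the tangent spaces being the
spaces of `ℂ`-derivations of the local rings `𝒪_{Y,y}` and `𝒪_{S,π(y)}` with values in the residue
field `κ(y)`. (At a closed point, `κ(y) = ℂ` and these are the Zariski tangent spaces; at
an arbitrary point this is the rank at `y` of `π^*Ω_S → Ω_Y`.) -/
noncomputable def differentialRank {Y S : Scheme.{0}} [Y.Over SpecC] [S.Over SpecC]
    (π : Y ⟶ S) [π.IsOver SpecC] (y : Y) : ℕ :=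
  letI : Algebra ℂ (S.presheaf.stalk (π y)) := (stalkStructureHom S (π y)).toAlgebra
  letI : Algebra ℂ (Y.presheaf.stalk y) := (stalkStructureHom Y y).toAlgebra
  letI : Algebra (S.presheaf.stalk (π y)) (Y.presheaf.stalk y) := (π.stalkMap y).hom.toAlgebra
  letI : Algebra (Y.presheaf.stalk y) (Y.residueField y) := (Y.residue y).hom.toAlgebra
  letI : Algebra ℂ (Y.residueField y) :=
    ((Y.residue y).hom.comp (stalkStructureHom Y y)).toAlgebra
  letI : Algebra (S.presheaf.stalk (π y)) (Y.residueField y) :=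
    ((Y.residue y).hom.comp (π.stalkMap y).hom).toAlgebra
  haveI : IsScalarTower ℂ (S.presheaf.stalk (π y)) (Y.presheaf.stalk y) :=
    .of_algebraMap_eq' (stalkMap_comp_stalkStructureHom π y).symm
  haveI : IsScalarTower ℂ (Y.presheaf.stalk y) (Y.residueField y) := .of_algebraMap_eq' rfl
  haveI : IsScalarTower (S.presheaf.stalk (π y)) (Y.presheaf.stalk y) (Y.residueField y) :=
    .of_algebraMap_eq' rfl
  haveI : IsScalarTower ℂ (S.presheaf.stalk (π y)) (Y.residueField y) :=
    .of_algebraMap_eq' (congrArg (Y.residue y).hom.comp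
      (stalkMap_comp_stalkStructureHom π y).symm)
  Module.finrank (Y.residueField y) (LinearMap.range
    (derivationPullback ℂ (S.presheaf.stalk (π y)) (Y.presheaf.stalk y) (Y.residueField y)))

/-- The locus `Y_d` in `Y` along which the rank of the differential of `π` equals `d`. -/
def rankLocus {Y S : Scheme.{0}} [Y.Over SpecC] [S.Over SpecC]
    (π : Y ⟶ S) [π.IsOver SpecC] (d : ℕ) : Set Y :=
  {y | differentialRank π y = d}

end Differential

/-- `π` is trim if `dim Y_d < d` for all `0 ≤ d < dim Y`. (The empty set has dimension `⊥`.) -/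
def IsTrim {Y S : Scheme.{0}} [Y.Over SpecC] [S.Over SpecC]
    (π : Y ⟶ S) [π.IsOver SpecC] : Prop :=
  ∀ d : ℕ, (d : WithBot ℕ∞) < topologicalKrullDim Y →
    topologicalKrullDim (rankLocus π d) < (d : WithBot ℕ∞)

/-- The fibers of `π` over the closed points of `Z` all have dimension `d`; that is,
`d(Z)` is defined and equal to `d`. -/
def HasFiberDim {Y S : Scheme.{0}} (π : Y ⟶ S) (Z : Set S) (d : ℕ) : Prop :=
  ∀ z ∈ Z, IsClosed {z} → topologicalKrullDim (π.fiber z) = (d : WithBot ℕ∞)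

/-- A finite partition into nonempty locally closed subsets. (Stratifications are usually required
to satisfy further conditions, such as nonsingularity of the strata, the frontier condition or
Whitney's conditions; none of these is imposed here, so that a statement about all stratifications
in this sense covers all of the more restrictive notions.) -/
structure Stratification (S : Scheme.{0}) where
  strata : Set (Set S)
  finite : strata.Finite
  nonempty : ∀ Z ∈ strata, Z.Nonempty
  isLocallyClosed : ∀ Z ∈ strata, IsLocallyClosed Z
  pairwiseDisjoint : strata.PairwiseDisjoint id
  sUnion_eq : ⋃₀ strata = Set.univ

/-- A stratification of `S` is adapted to `π : Y ⟶ S` if the dimension of the fibers of `π` is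
constant along each stratum. -/
def Stratification.IsAdapted {Y S : Scheme.{0}} (𝒮 : Stratification S) (π : Y ⟶ S) : Prop :=
  ∀ Z ∈ 𝒮.strata, ∃ d : ℕ, HasFiberDim π Z d

/-- The inequality `2 d < codim_S Z = dim S - dim Z`. -/
def TwiceLtCodim {S : Scheme.{0}} (d : ℕ) (Z : Set S) : Prop :=
  ((2 * d : ℕ) : WithBot ℕ∞) + topologicalKrullDim Z < topologicalKrullDim S

/-- A morphism is small if it is proper and surjective, source and target have the same dimension,
and `2 d(Z) < codim_S Z` for all proper (that is, non-dense) strata `Z` of adapted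
stratifications. -/
structure IsSmall {Y S : Scheme.{0}} (π : Y ⟶ S) : Prop where
  isProper : IsProper π
  surjective : Function.Surjective π
  dim_eq : topologicalKrullDim Y = topologicalKrullDim S
  twice_lt_codim : ∀ 𝒮 : Stratification S, 𝒮.IsAdapted π →
    ∀ Z ∈ 𝒮.strata, ¬ Dense Z → ∀ d : ℕ, HasFiberDim π Z d → TwiceLtCodim d Z

end TrimMaps

/-! Write n for the common dimension of Y and S, and call the transcendence degree over ℂ of the
residue field of a scheme point its dimension (`pointDim`); it equals the dimension of the closure
of the point. Let z be any point of Z, closed or not. Constancy of the fiber dimension d over closed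
points yields a point y over z with dim z + d ≤ dim y (`exists_pointDim_add_le_of_hasFiberDim`).

Let r be the rank of dπ at y and c the dimension of κ(y) ⊗ Ω_{Y/S}. Three facts are combined
(`exists_differentialRank_bounds`). Rank-nullity on a smooth Y gives r + c ≤ n. Since κ(y)/κ(z) has
transcendence degree at most c, dim y ≤ dim z + c, hence d ≤ c. Finally r is constant on a dense
open part of the closure of y, so dim y ≤ dim Y_r.

If r < n, trimness gives dim y < r, so dim z + d ≤ dim y < r ≤ n - c ≤ n - d. If r = n, then c = 0
and d = 0, and dim z < n because Z is not dense. In both cases dim z + 2d < n for all z in Z; as dim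
Z is bounded by the dimensions of its points, the inequality follows. -/

namespace TrimMaps

/-! ### Generic Noether normalization and the dimension of fibers -/

theorem ringKrullDim_eq_of_isIntegral {R S : Type*} [CommRing R] [CommRing S] [Algebra R S]
    [Algebra.IsIntegral R S] [FaithfulSMul R S] : ringKrullDim S = ringKrullDim R := by
  apply le_antisymm
  · refine Order.krullDim_le_of_strictMono (PrimeSpectrum.comap (algebraMap R S)) ?_
    intro p q hpq
    exact Ideal.IsIntegral.comap_lt_comap (R := R) hpq
  · refine iSup_le fun l => ?_
    obtain ⟨P, _, hP⟩ := Ideal.nonempty_primesOver (S := S) l.head.asIdeal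
    obtain ⟨L, hL, -⟩ := Ideal.exists_ltSeries_of_hasGoingUp (S := S) l P
    rw [← hL]
    exact Order.LTSeries.length_le_krullDim L

theorem ringKrullDim_eq_trdeg (k R : Type*) [Field k] [CommRing R] [IsDomain R] [Algebra k R]
    [Algebra.FiniteType k R] :
    ringKrullDim R = ((Algebra.trdeg k R).toNat : WithBot ℕ∞) := by
  obtain ⟨s, g, hg, hint⟩ := exists_integral_inj_algHom_of_fg k R
  algebraize [g.toRingHom]
  have : Algebra.IsIntegral (MvPolynomial (Fin s) k) R := ⟨hint⟩
  have : FaithfulSMul (MvPolynomial (Fin s) k) R := (faithfulSMul_iff_algebraMap_injective _ _).2 hg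
  rw [ringKrullDim_eq_of_isIntegral (R := MvPolynomial (Fin s) k),
    MvPolynomial.ringKrullDim_of_isNoetherianRing, ringKrullDim_eq_zero_of_field]
  have h := lift_trdeg_add_eq k (MvPolynomial (Fin s) k) R
  rw [MvPolynomial.trdeg_of_isDomain, trdeg_eq_zero] at h
  have h2 := congrArg Cardinal.toNat h
  simp at h2
  rw [← h2]; simp

-- Normalize the generic fiber over the fraction field; multiplying the parameters by a common
-- denominator brings them into B.
open TensorProduct nonZeroDivisors MvPolynomial in
theorem exists_noetherNormalization_generic (R B : Type*) [CommRing R] [IsDomain R] [CommRing B]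
    [Algebra R B] [Algebra.FiniteType R B] [Nontrivial (FractionRing R ⊗[R] B)] :
    ∃ (s : ℕ) (y : Fin s → B),
      Function.Injective (aeval (R := FractionRing R)
        (fun i => (1 : FractionRing R) ⊗ₜ[R] y i)) ∧
      (aeval (R := FractionRing R) (fun i => (1 : FractionRing R) ⊗ₜ[R] y i)).IsIntegral := by
  obtain ⟨s, g, hg, hint⟩ := exists_integral_inj_algHom_of_fg (FractionRing R) (FractionRing R ⊗[R] B)
  obtain ⟨r, hr⟩ := IsLocalizedModule.exist_integer_multiples_of_finite R⁰
    (TensorProduct.mk R (FractionRing R) B 1) (fun i : Fin s => g (X i))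
  choose y hy using hr
  set ρ : FractionRing R := algebraMap R (FractionRing R) r with hρ
  have hρ0 : ρ ≠ 0 := IsFractionRing.to_map_ne_zero_of_mem_nonZeroDivisors r.2
  have hy' (i : Fin s) : (1 : FractionRing R) ⊗ₜ[R] y i = ρ • g (X i) := by
    rw [hρ, algebraMap_smul]; exact hy i
  -- Rescaling the variables by ρ or its inverse is invertible, so it preserves injectivity and
  -- integrality.
  let σ : MvPolynomial (Fin s) (FractionRing R) →ₐ[FractionRing R]
    MvPolynomial (Fin s) (FractionRing R) := aeval fun i => ρ⁻¹ • X i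
  let τ : MvPolynomial (Fin s) (FractionRing R) →ₐ[FractionRing R]
    MvPolynomial (Fin s) (FractionRing R) := aeval fun i => ρ • X i
  have h1 : (aeval (R := FractionRing R) (fun i => (1 : FractionRing R) ⊗ₜ[R] y i)).comp σ = g := by
    ext i
    simp only [σ, AlgHom.comp_apply, aeval_X, map_smul, hy']
    rw [smul_smul, inv_mul_cancel₀ hρ0, one_smul]
  have h2 : g.comp τ = aeval (R := FractionRing R) (fun i => (1 : FractionRing R) ⊗ₜ[R] y i) := by
    ext i
    simp only [τ, AlgHom.comp_apply, aeval_X, map_smul, hy']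
  have h3 : σ.comp τ = AlgHom.id _ _ := by
    ext1 i
    simp only [σ, τ, AlgHom.comp_apply, aeval_X, map_smul, AlgHom.id_apply]
    rw [smul_smul, mul_inv_cancel₀ hρ0, one_smul]
  refine ⟨s, y, ?_, ?_⟩
  · rw [← h2]
    refine hg.comp (Function.LeftInverse.injective (g := σ) fun x => ?_)
    exact DFunLike.congr_fun h3 x
  · refine RingHom.IsIntegral.tower_top σ.toRingHom _ ?_
    have : g.toRingHom.IsIntegral := hint
    rw [← h1] at this
    exact this

-- Clearing denominators in an integral equation of 1 ⊗ b gives an equation valid in B up to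
-- R-torsion; a second factor c kills that torsion.
open TensorProduct nonZeroDivisors MvPolynomial in
theorem exists_isIntegralElem_smul {R B : Type*} [CommRing R] [IsDomain R] [CommRing B]
    [Algebra R B] {s : ℕ} (y : Fin s → B)
    (h : (aeval (R := FractionRing R) (fun i => (1 : FractionRing R) ⊗ₜ[R] y i)).IsIntegral)
    (b : B) : ∃ r ∈ R⁰, (aeval (R := R) y).toRingHom.IsIntegralElem (r • b) := by
  have hA : (aeval (R := R) (fun i => (1 : FractionRing R) ⊗ₜ[R] y i)) =
      (Algebra.TensorProduct.includeRight (R := R) (A := FractionRing R)).comp (aeval y) := by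
    ext i; simp
  let := algebraMvPolynomial (R := R) (S := FractionRing R) (σ := Fin s)
  let a1 : Algebra (MvPolynomial (Fin s) R) B := (aeval y).toAlgebra
  let a2 : Algebra (MvPolynomial (Fin s) (FractionRing R)) (FractionRing R ⊗[R] B) :=
    (aeval (R := FractionRing R) (fun i => (1 : FractionRing R) ⊗ₜ[R] y i)).toAlgebra
  let a3 : Algebra (MvPolynomial (Fin s) R) (FractionRing R ⊗[R] B) :=
    (aeval (R := R) (fun i => (1 : FractionRing R) ⊗ₜ[R] y i)).toAlgebra
  have : IsScalarTower (MvPolynomial (Fin s) R) (MvPolynomial (Fin s) (FractionRing R))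
      (FractionRing R ⊗[R] B) := by
    refine .of_algebraMap_eq fun p => ?_
    change aeval _ p = aeval _ (MvPolynomial.map (algebraMap R (FractionRing R)) p)
    rw [aeval_map_algebraMap]
  obtain ⟨⟨_, r, hr, rfl⟩, p, hp, hpe⟩ := IsIntegral.exists_multiple_integral_of_isLocalization
    (R := MvPolynomial (Fin s) R) (Rₘ := MvPolynomial (Fin s) (FractionRing R))
    (R⁰.map (C (σ := Fin s))) ((1 : FractionRing R) ⊗ₜ[R] b) (h _)
  have e1 : (algebraMap (MvPolynomial (Fin s) R) (FractionRing R ⊗[R] B)) =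
    (Algebra.TensorProduct.includeRight (R := R) (A := FractionRing R)).toRingHom.comp
      (aeval y).toRingHom := congrArg AlgHom.toRingHom hA
  have e2 : (C r : MvPolynomial (Fin s) R) • ((1 : FractionRing R) ⊗ₜ[R] b) =
      (Algebra.TensorProduct.includeRight (R := R) (A := FractionRing R)).toRingHom (r • b) := by
    rw [Algebra.smul_def]
    change aeval _ (C r) * _ = (1 : FractionRing R) ⊗ₜ[R] (r • b)
    rw [aeval_C, ← Algebra.smul_def, TensorProduct.tmul_smul]
  rw [Submonoid.smul_def] at hpe
  change Polynomial.eval₂ (algebraMap (MvPolynomial (Fin s) R) (FractionRing R ⊗[R] B))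
    ((C r : MvPolynomial (Fin s) R) • ((1 : FractionRing R) ⊗ₜ[R] b)) p = 0 at hpe
  rw [e1, e2, ← Polynomial.hom_eval₂] at hpe
  obtain ⟨⟨c, hc⟩, hce⟩ := (IsLocalizedModule.eq_zero_iff R⁰
    (TensorProduct.mk R (FractionRing R) B 1)).1 hpe
  rw [Submonoid.mk_smul] at hce
  refine ⟨c * r, mul_mem hc hr, ?_⟩
  -- Scaling roots by c multiplies the value by a power of c with exponent deg p. In degree 0 this
  -- power is 1 and does not help, but then p = 1 and c annihilates B.
  by_cases hd : 1 ≤ p.natDegree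
  · refine ⟨p.scaleRoots (C c), (Polynomial.monic_scaleRoots_iff _).mpr hp, ?_⟩
    have := p.scaleRoots_eval₂_mul (aeval (R := R) y).toRingHom (r • b) (C c)
    have e3 : (aeval (R := R) y).toRingHom (C c) = algebraMap R B c := by
      change aeval y (C c) = _
      simp
    rw [e3, ← Algebra.smul_def, smul_smul] at this
    rw [this, ← tsub_add_cancel_of_le hd, pow_succ, mul_assoc, ← Algebra.smul_def, hce, mul_zero]
  · obtain rfl : p = 1 := Polynomial.eq_one_of_monic_natDegree_zero hp (by lia)
    simp only [Polynomial.eval₂_one] at hce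
    refine ⟨Polynomial.X, Polynomial.monic_X, ?_⟩
    rw [Polynomial.eval₂_X, mul_smul, Algebra.smul_def c, Algebra.algebraMap_eq_smul_one, hce,
      zero_mul]

-- The product f of the denominators of finitely many generators serves all of B, with an exponent
-- depending on b: after inverting f, B is integral over R[y].
open TensorProduct nonZeroDivisors MvPolynomial in
theorem exists_isIntegralElem_pow_smul {R B : Type*} [CommRing R] [IsDomain R] [CommRing B]
    [Algebra R B] [Algebra.FiniteType R B] {s : ℕ} (y : Fin s → B)
    (h : (aeval (R := FractionRing R) (fun i => (1 : FractionRing R) ⊗ₜ[R] y i)).IsIntegral) :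
    ∃ f : R, f ≠ 0 ∧ ∀ b : B, ∃ N : ℕ,
      (aeval (R := R) y).toRingHom.IsIntegralElem (f ^ N • b) := by
  obtain ⟨S, hS⟩ := (Algebra.FiniteType.out : (⊤ : Subalgebra R B).FG)
  choose r hr hri using exists_isIntegralElem_smul y h
  refine ⟨∏ b ∈ S, r b, nonZeroDivisors.ne_zero (prod_mem fun b _ => hr b), fun b => ?_⟩
  have hC (a : R) : (aeval (R := R) y).toRingHom.IsIntegralElem (algebraMap R B a) := by
    have := RingHom.isIntegralElem_map (aeval (R := R) y).toRingHom (x := C a)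
    simpa using this
  have hsm (a : R) (x : B) (hx : (aeval (R := R) y).toRingHom.IsIntegralElem x) :
      (aeval (R := R) y).toRingHom.IsIntegralElem (a • x) := by
    rw [Algebra.smul_def]; exact RingHom.IsIntegralElem.mul _ (hC a) hx
  have hb : b ∈ Algebra.adjoin R (S : Set B) := hS ▸ Algebra.mem_top
  induction hb using Algebra.adjoin_induction with
  | mem x hx =>
    refine ⟨1, ?_⟩
    classical
    rw [pow_one, ← Finset.prod_erase_mul _ _ hx, mul_smul]
    exact hsm _ _ (hri x)
  | algebraMap a => exact ⟨0, by simpa using hC a⟩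
  | add x z _ _ hx hz =>
    obtain ⟨N, hN⟩ := hx
    obtain ⟨M, hM⟩ := hz
    refine ⟨M + N, ?_⟩
    rw [smul_add]
    refine RingHom.IsIntegralElem.add _ ?_ ?_
    · rw [pow_add, mul_smul]; exact hsm _ _ hN
    · rw [add_comm, pow_add, mul_smul]; exact hsm _ _ hM
  | mul x z _ _ hx hz =>
    obtain ⟨N, hN⟩ := hx
    obtain ⟨M, hM⟩ := hz
    refine ⟨N + M, ?_⟩
    rw [pow_add, ← smul_mul_smul_comm]
    exact RingHom.IsIntegralElem.mul _ hN hM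

theorem krullDim_fiber_mvPolynomial (R : Type*) [CommRing R] (s : ℕ) (p : PrimeSpectrum R) :
    Order.krullDim
      (PrimeSpectrum.comap (algebraMap R (MvPolynomial (Fin s) R)) ⁻¹' {p}) = (s : WithBot ℕ∞) := by
  rw [Order.krullDim_eq_of_orderIso
      (PrimeSpectrum.preimageOrderIsoFiber R (MvPolynomial (Fin s) R) p), ← ringKrullDim,
      ringKrullDim_eq_of_ringEquiv
        (MvPolynomial.algebraTensorAlgEquiv R p.asIdeal.ResidueField).toRingEquiv]
  simp [ringKrullDim_eq_zero_of_field]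

-- Where f is invertible, B is integral over R[y₁, …, yₛ], so chains in a fiber map to strict chains
-- in affine s-space and have length at most s. A prime of the generic fiber lying over 0 contracts
-- to some q modulo which the yᵢ stay algebraically independent, so s is attained over the generic
-- point.
open TensorProduct nonZeroDivisors MvPolynomial in
theorem exists_length_fiber_le_trdeg (R B : Type*) [CommRing R] [IsDomain R] [CommRing B]
    [Algebra R B] [Algebra.FiniteType R B] :
    ∃ f : R, f ≠ 0 ∧ ∀ p : PrimeSpectrum R, f ∉ p.asIdeal →
      ∀ l : LTSeries (PrimeSpectrum.comap (algebraMap R B) ⁻¹' {p}),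
        ∃ q : Ideal B, q.IsPrime ∧ q.comap (algebraMap R B) = ⊥ ∧
          (l.length : Cardinal) ≤ Algebra.trdeg R (B ⧸ q) := by
  rcases subsingleton_or_nontrivial (FractionRing R ⊗[R] B) with hT | hT
  -- Empty generic fiber: a nonzero c kills B, so the fibers where c does not vanish are empty and
  -- contain no chain.
  · obtain ⟨⟨c, hc⟩, hce⟩ := (IsLocalizedModule.eq_zero_iff R⁰
      (TensorProduct.mk R (FractionRing R) B 1)).1 (Subsingleton.elim (TensorProduct.mk R _ B 1 1) 0)
    refine ⟨c, nonZeroDivisors.ne_zero hc, fun p hcp l => (hcp ?_).elim⟩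
    have h0 : algebraMap R B c = 0 := by
      rw [Algebra.algebraMap_eq_smul_one]; exact hce
    have h1 : PrimeSpectrum.comap (algebraMap R B) l.head.1 = p := l.head.2
    rw [← h1, PrimeSpectrum.comap_asIdeal, Ideal.mem_comap, h0]
    exact zero_mem _
  · obtain ⟨s, y, hinj, hint⟩ := exists_noetherNormalization_generic R B
    obtain ⟨f, hf, hfi⟩ := exists_isIntegralElem_pow_smul y hint
    refine ⟨f, hf, fun p hfp l => ?_⟩
    have hcomp : (aeval (R := R) y).toRingHom.comp (algebraMap R (MvPolynomial (Fin s) R)) =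
        algebraMap R B := (aeval (R := R) y).comp_algebraMap
    have hls : l.length ≤ s := by
      let φ : PrimeSpectrum.comap (algebraMap R B) ⁻¹' {p} →
          PrimeSpectrum.comap (algebraMap R (MvPolynomial (Fin s) R)) ⁻¹' {p} := fun q =>
        ⟨PrimeSpectrum.comap (aeval (R := R) y).toRingHom q.1, by
          rw [Set.mem_preimage, ← PrimeSpectrum.comap_comp_apply, hcomp]; exact q.2⟩
      have hφ : StrictMono φ := by
        rintro ⟨q, hq⟩ ⟨q', hq'⟩ hlt
        have hlt' : q < q' := hlt
        obtain ⟨hle, b, hb', hb⟩ := SetLike.lt_iff_le_and_exists.1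
          (show q.asIdeal < q'.asIdeal from hlt')
        obtain ⟨N, P, hP, hPe⟩ := hfi b
        have hfq : algebraMap R B f ∉ q.asIdeal := by
          have h1 : PrimeSpectrum.comap (algebraMap R B) q = p := hq
          rwa [← Ideal.mem_comap, ← PrimeSpectrum.comap_asIdeal, h1]
        refine Ideal.comap_lt_comap_of_root_mem_sdiff (f := (aeval (R := R) y).toRingHom) hle
          (r := f ^ N • b) ⟨?_, ?_⟩ (p := P) ?_ ?_
        · rw [Algebra.smul_def]; exact Ideal.mul_mem_left _ _ hb'
        · rw [Algebra.smul_def, map_pow]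
          exact fun h => (q.2.mem_or_mem h).elim (fun h => hfq (q.2.mem_of_pow_mem _ h)) hb
        · have : (Ideal.comap (aeval (R := R) y).toRingHom q.asIdeal).IsPrime :=
            Ideal.comap_isPrime _ _
          exact (hP.map _).ne_zero
        · rw [hPe]; exact zero_mem _
      have := Order.LTSeries.length_le_krullDim (l.map φ hφ)
      rw [krullDim_fiber_mvPolynomial] at this
      exact_mod_cast this
    let : Algebra (MvPolynomial (Fin s) (FractionRing R)) (FractionRing R ⊗[R] B) :=
      (aeval (R := FractionRing R) (fun i => (1 : FractionRing R) ⊗ₜ[R] y i)).toAlgebra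
    have : Algebra.IsIntegral (MvPolynomial (Fin s) (FractionRing R)) (FractionRing R ⊗[R] B) :=
      ⟨hint⟩
    have : FaithfulSMul (MvPolynomial (Fin s) (FractionRing R)) (FractionRing R ⊗[R] B) :=
      (faithfulSMul_iff_algebraMap_injective _ _).2 hinj
    obtain ⟨Q, hQ, hQ0⟩ := Ideal.nonempty_primesOver (S := FractionRing R ⊗[R] B)
      (⊥ : Ideal (MvPolynomial (Fin s) (FractionRing R)))
    let ι : B →ₐ[R] FractionRing R ⊗[R] B := Algebra.TensorProduct.includeRight
    have hmem (P : MvPolynomial (Fin s) R) (hP : aeval y P ∈ Q.comap ι.toRingHom) : P = 0 := by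
      have h1 : map (algebraMap R (FractionRing R)) P ∈
          Q.under (MvPolynomial (Fin s) (FractionRing R)) := by
        rw [Ideal.mem_comap]
        change aeval (R := FractionRing R) (fun i => (1 : FractionRing R) ⊗ₜ[R] y i)
          (map (algebraMap R (FractionRing R)) P) ∈ Q
        rw [aeval_map_algebraMap]
        change aeval (fun i => ι (y i)) P ∈ Q
        rw [← comp_aeval]
        exact hP
      rw [← hQ0.over, Ideal.mem_bot] at h1
      exact map_injective _ (IsFractionRing.injective R (FractionRing R)) (by rw [h1, map_zero])
    refine ⟨Q.comap ι.toRingHom, Ideal.comap_isPrime _ _, ?_, ?_⟩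
    · refine le_bot_iff.1 fun r hr => ?_
      have h2 := hmem (C r) (by simpa using hr)
      simpa using h2
    · have hai : AlgebraicIndependent R (fun i => Ideal.Quotient.mkₐ R (Q.comap ι.toRingHom) (y i)) := by
        rw [algebraicIndependent_iff]
        intro P hP
        refine hmem P ?_
        rw [← Ideal.Quotient.eq_zero_iff_mem]
        rw [← hP]
        exact DFunLike.congr_fun (comp_aeval (R := R) y
          (Ideal.Quotient.mkₐ R (Q.comap ι.toRingHom))) P
      have : Nontrivial R := inferInstance
      have h3 := hai.lift_cardinalMk_le_trdeg
      simp only [Cardinal.mk_fin, Cardinal.lift_natCast] at h3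
      refine le_trans (Nat.cast_le.2 hls) ?_
      simpa using h3

/-- The preceding result for A/p → B/pB, with transcendence degrees turned into Krull dimensions by
their additivity in towers. It carries a chain in the fiber over a general point of V(p) to a point
over p itself. -/
theorem exists_notMem_length_fiber_add_le {k A B : Type} [Field k] [CommRing A] [CommRing B]
    [Algebra k A] [Algebra k B] [Algebra A B] [IsScalarTower k A B] [Algebra.FiniteType k A]
    [Algebra.FiniteType k B] (p : Ideal A) [p.IsPrime] :
    ∃ f ∉ p, ∀ p' : PrimeSpectrum A, p ≤ p'.asIdeal → f ∉ p'.asIdeal →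
      ∀ l : LTSeries (PrimeSpectrum.comap (algebraMap A B) ⁻¹' {p'}),
        ∃ q : Ideal B, q.IsPrime ∧ q.comap (algebraMap A B) = p ∧
          ringKrullDim (A ⧸ p) + (l.length : WithBot ℕ∞) ≤ ringKrullDim (B ⧸ q) := by
  let B' := B ⧸ p.map (algebraMap A B)
  have : Algebra.FiniteType A B := .of_restrictScalars_finiteType k A B
  have : Algebra.FiniteType (A ⧸ p) B' := by
    have : Algebra.FiniteType A B' := inferInstance
    exact .of_restrictScalars_finiteType A (A ⧸ p) B'
  obtain ⟨f, hf, H⟩ := exists_length_fiber_le_trdeg (A ⧸ p) B'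
  obtain ⟨f, rfl⟩ := Ideal.Quotient.mk_surjective f
  refine ⟨f, fun h => hf (Ideal.Quotient.eq_zero_iff_mem.2 h), fun p' hpp' hfp' l => ?_⟩
  have hmk : Function.Surjective (Ideal.Quotient.mk p) := Ideal.Quotient.mk_surjective
  have hmk' : Function.Surjective (Ideal.Quotient.mk (p.map (algebraMap A B))) :=
    Ideal.Quotient.mk_surjective
  have hsq : (algebraMap (A ⧸ p) B').comp (Ideal.Quotient.mk p) =
    (Ideal.Quotient.mk (p.map (algebraMap A B))).comp (algebraMap A B) := rfl
  obtain ⟨p'', rfl⟩ : p' ∈ Set.range (PrimeSpectrum.comap (Ideal.Quotient.mk p)) := by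
    rw [_root_.range_comap_of_surjective _ _ hmk, Ideal.mk_ker]; exact hpp'
  have hlift (q : PrimeSpectrum.comap (algebraMap A B) ⁻¹'
      {PrimeSpectrum.comap (Ideal.Quotient.mk p) p''}) :
      ∃ q' : PrimeSpectrum B', PrimeSpectrum.comap (Ideal.Quotient.mk _) q' = q.1 := by
    change q.1 ∈ Set.range _
    rw [_root_.range_comap_of_surjective _ _ hmk', Ideal.mk_ker]
    change p.map (algebraMap A B) ≤ q.1.asIdeal
    rw [Ideal.map_le_iff_le_comap]
    have h1 : PrimeSpectrum.comap (algebraMap A B) q.1 = _ := q.2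
    rwa [← PrimeSpectrum.comap_asIdeal, h1]
  choose ψ hψ using hlift
  let φ (q) : PrimeSpectrum.comap (algebraMap (A ⧸ p) B') ⁻¹' {p''} := ⟨ψ q, by
    apply PrimeSpectrum.comap_injective_of_surjective _ hmk
    rw [← PrimeSpectrum.comap_comp_apply, hsq, PrimeSpectrum.comap_comp_apply, hψ]
    exact q.2⟩
  have hφ : StrictMono φ := by
    intro q q' hlt
    have hlt' : q.1 < q'.1 := hlt
    rw [← hψ q, ← hψ q'] at hlt'
    change ψ q < ψ q'
    rw [lt_iff_le_not_ge] at hlt' ⊢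
    exact ⟨(Ideal.comap_le_comap_iff_of_surjective _ hmk' _ _).1 hlt'.1,
      fun h => hlt'.2 (Ideal.comap_mono h)⟩
  obtain ⟨q, hq, hq0, hql⟩ := H p'' hfp' (l.map φ hφ)
  refine ⟨q.comap (Ideal.Quotient.mk _), Ideal.comap_isPrime _ _, ?_, ?_⟩
  · rw [Ideal.comap_comap, ← hsq, ← Ideal.comap_comap, hq0, ← RingHom.ker_eq_comap_bot,
      Ideal.mk_ker]
  · have hsurj : Function.Surjective (Ideal.quotientMap (I := q.comap (Ideal.Quotient.mk _)) q
        (Ideal.Quotient.mk (p.map (algebraMap A B))) le_rfl) :=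
      Ideal.quotientMap_surjective hmk'
    refine le_trans ?_ (ringKrullDim_le_of_surjective _ hsurj)
    have : FaithfulSMul (A ⧸ p) (B' ⧸ q) := by
      rw [faithfulSMul_iff_algebraMap_injective, IsScalarTower.algebraMap_eq (A ⧸ p) B' (B' ⧸ q),
        RingHom.injective_iff_ker_eq_bot, ← RingHom.comap_ker, Ideal.Quotient.algebraMap_eq,
        Ideal.mk_ker, hq0]
    have : IsScalarTower k (A ⧸ p) (B' ⧸ q) := .of_algebraMap_eq fun x =>
      congrArg (fun b => Ideal.Quotient.mk q (Ideal.Quotient.mk (p.map (algebraMap A B)) b))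
        (IsScalarTower.algebraMap_apply k A B x)
    have h1 := trdeg_add_eq k (A ⧸ p) (A := B' ⧸ q)
    have hfin : Algebra.trdeg k (B' ⧸ q) < Cardinal.aleph0 := trdeg_lt_aleph0_of_finiteType
    rw [ringKrullDim_eq_trdeg k (A ⧸ p), ringKrullDim_eq_trdeg k (B' ⧸ q)]
    rw [← h1] at hfin ⊢
    have h2 := Cardinal.add_lt_aleph0_iff.1 hfin
    rw [Cardinal.toNat_add h2.1 h2.2]
    have h3 := Cardinal.toNat_le_toNat hql h2.2
    rw [Cardinal.toNat_natCast] at h3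
    have h4 : l.length ≤ Cardinal.toNat (Algebra.trdeg (A ⧸ p) (B' ⧸ q)) := h3
    exact_mod_cast Nat.add_le_add_left h4 _

end TrimMaps

/-! ### Derivations, Kähler differentials and the rank of the differential -/

namespace TrimMaps
open TensorProduct

noncomputable def derivationEquivDual (R B K : Type*) [CommRing R] [CommRing B] [Field K]
    [Algebra R B] [Algebra B K] [Algebra R K] [IsScalarTower R B K] :
    Derivation R B K ≃ₗ[K] Module.Dual K (K ⊗[B] Ω[B⁄R]) :=
  ({ (KaehlerDifferential.linearMapEquivDerivation R B (M := K)).symm.toEquiv with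
      map_add' := map_add (KaehlerDifferential.linearMapEquivDerivation R B (M := K)).symm
      map_smul' := fun c D => by
        apply (KaehlerDifferential.linearMapEquivDerivation R B (M := K)).injective
        ext x
        simp } :
    Derivation R B K ≃ₗ[K] (Ω[B⁄R] →ₗ[B] K)) ≪≫ₗ LinearMap.liftBaseChangeEquiv K

theorem finrank_derivation (R B K : Type*) [CommRing R] [CommRing B] [Field K]
    [Algebra R B] [Algebra B K] [Algebra R K] [IsScalarTower R B K] :
    Module.finrank K (Derivation R B K) = Module.finrank K (K ⊗[B] Ω[B⁄R]) := by
  rw [(derivationEquivDual R B K).finrank_eq, Subspace.dual_finrank_eq]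

theorem finite_derivation (R B K : Type*) [CommRing R] [CommRing B] [Field K]
    [Algebra R B] [Algebra B K] [Algebra R K] [IsScalarTower R B K] [Algebra.EssFiniteType R B] :
    Module.Finite K (Derivation R B K) :=
  Module.Finite.equiv (derivationEquivDual R B K).symm

section

variable (k A B K : Type) [CommRing k] [CommRing A] [CommRing B]
    [Field K] [Algebra k A] [Algebra k B] [Algebra A B] [Algebra k K] [Algebra A K] [Algebra B K]
    [IsScalarTower k A B] [IsScalarTower k A K] [IsScalarTower k B K] [IsScalarTower A B K]

noncomputable def kerDerivationPullbackEquiv :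
    LinearMap.ker (derivationPullback k A B K) ≃ₗ[K] Derivation A B K where
  toFun D :=
    { toFun := D.1
      map_add' := map_add _
      map_smul' := fun a b => by
        have h : D.1 (algebraMap A B a) = 0 := DFunLike.congr_fun D.2 a
        rw [Algebra.smul_def, D.1.leibniz, h, smul_zero, add_zero, RingHom.id_apply,
          algebraMap_smul]
      map_one_eq_zero' := D.1.map_one_eq_zero
      leibniz' := D.1.leibniz }
  map_add' _ _ := rfl
  map_smul' _ _ := rfl
  invFun D := ⟨D.restrictScalars k, by
    ext a
    exact D.map_algebraMap a⟩
  left_inv _ := rfl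
  right_inv _ := rfl

/-- Rank-nullity: the derivations killed by restriction to A are exactly the A-linear ones, and
derivations into K are dual to K ⊗ Ω. -/
theorem finrank_range_derivationPullback_add [Algebra.EssFiniteType k B] :
    Module.finrank K (LinearMap.range (derivationPullback k A B K)) +
      Module.finrank K (K ⊗[B] Ω[B⁄A]) = Module.finrank K (K ⊗[B] Ω[B⁄k]) := by
  have := finite_derivation k B K
  rw [← finrank_derivation, ← finrank_derivation, ← (kerDerivationPullbackEquiv k A B K).finrank_eq,
    LinearMap.finrank_range_add_finrank_ker]

theorem derivationPullback_injective_of_isLocalization (M : Submonoid A) [IsLocalization M B] :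
    Function.Injective (derivationPullback k A B K) := by
  rw [← LinearMap.ker_eq_bot, ← Submodule.subsingleton_iff_eq_bot]
  have : Algebra.FormallyUnramified A B := .of_isLocalization M
  have : Subsingleton (Derivation A B K) :=
    (KaehlerDifferential.linearMapEquivDerivation A B (M := K)).symm.toEquiv.subsingleton
  exact (kerDerivationPullbackEquiv k A B K).toEquiv.subsingleton

theorem derivationPullback_surjective_of_isLocalization (M : Submonoid A) [IsLocalization M B] :
    Function.Surjective (derivationPullback k A B K) := by
  intro D
  have : Algebra.FormallyEtale A B := .of_isLocalization M
  let l : Ω[B⁄k] →ₗ[B] K := (D.liftKaehlerDifferential.liftBaseChange B) ∘ₗ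
    (KaehlerDifferential.tensorKaehlerEquivOfFormallyEtale k A B).symm.toLinearMap
  refine ⟨l.compDer (KaehlerDifferential.D k B), ?_⟩
  ext a
  change l (KaehlerDifferential.D k B (algebraMap A B a)) = D a
  simp only [l, LinearMap.comp_apply, LinearEquiv.coe_coe,
    KaehlerDifferential.tensorKaehlerEquivOfFormallyEtale_symm_D_algebraMap]
  simp

end

/-- The differential is defined on local rings; this moves its rank to rings of finite type.
Restriction along B → Bq is onto and along A → Ap is injective, so the rank is unchanged. -/
theorem finrank_range_derivationPullback_localization_add
    (k A B Ap Bq K : Type) [CommRing k] [CommRing A] [CommRing B] [CommRing Ap] [CommRing Bq]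
    [Field K] [Algebra k A] [Algebra k B] [Algebra A B] [Algebra k K] [Algebra A K] [Algebra B K]
    [IsScalarTower k A B] [IsScalarTower k A K] [IsScalarTower k B K] [IsScalarTower A B K]
    [Algebra k Ap] [Algebra k Bq] [Algebra Ap Bq] [Algebra Ap K] [Algebra Bq K]
    [IsScalarTower k Ap Bq] [IsScalarTower k Ap K] [IsScalarTower k Bq K] [IsScalarTower Ap Bq K]
    [Algebra A Ap] [Algebra B Bq] [IsScalarTower k A Ap] [IsScalarTower k B Bq]
    [IsScalarTower A Ap K] [IsScalarTower B Bq K] [Algebra A Bq] [IsScalarTower A Ap Bq]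
    [IsScalarTower A B Bq]
    (M : Submonoid A) (N : Submonoid B) [IsLocalization M Ap] [IsLocalization N Bq]
    [Algebra.EssFiniteType k B] :
    Module.finrank K (LinearMap.range (derivationPullback k Ap Bq K)) +
      Module.finrank K (K ⊗[B] Ω[B⁄A]) = Module.finrank K (K ⊗[B] Ω[B⁄k]) := by
  rw [← finrank_range_derivationPullback_add k A B K]
  congr 1
  have hcomm : derivationPullback k A Ap K ∘ₗ derivationPullback k Ap Bq K =
      derivationPullback k A B K ∘ₗ derivationPullback k B Bq K := by
    ext D a
    change D (algebraMap Ap Bq (algebraMap A Ap a)) = D (algebraMap B Bq (algebraMap A B a))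
    rw [← IsScalarTower.algebraMap_apply, ← IsScalarTower.algebraMap_apply]
  rw [← LinearMap.range_comp_of_range_eq_top (derivationPullback k A B K) (LinearMap.range_eq_top.2
    (derivationPullback_surjective_of_isLocalization k B Bq K N)), ← hcomm, LinearMap.range_comp]
  exact (Submodule.equivMapOfInjective _
    (derivationPullback_injective_of_isLocalization k A Ap K M) _).finrank_eq

end TrimMaps

/-! ### Transcendence degree and differentials of field extensions -/

namespace TrimMaps
open TensorProduct

-- Choose elements x whose differentials form a basis. Then L is unramified, hence separable
-- algebraic, over K(x), so the number of elements bounds the transcendence degree.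
open IntermediateField.algebraAdjoinAdjoin in
theorem trdeg_le_finrank_kaehlerDifferential (K L : Type) [Field K] [Field L] [Algebra K L]
    [Algebra.EssFiniteType K L] :
    Algebra.trdeg K L ≤ Module.finrank L Ω[L⁄K] := by
  obtain ⟨b, hb, hspan, hli⟩ := exists_linearIndependent L (Set.range (KaehlerDifferential.D K L))
  have hspan' : Submodule.span L b = ⊤ := by
    rw [hspan, KaehlerDifferential.span_range_derivation]
  choose x hx using fun z : b => hb z.2
  have : Algebra.EssFiniteType (IntermediateField.adjoin K (Set.range x)) L :=
    .of_comp K (IntermediateField.adjoin K (Set.range x)) L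
  have hsub : Subsingleton Ω[L⁄(IntermediateField.adjoin K (Set.range x))] := by
    have htop : LinearMap.ker (KaehlerDifferential.map K (IntermediateField.adjoin K (Set.range x)) L
        L) = ⊤ := by
      rw [← top_le_iff, ← hspan', Submodule.span_le]
      intro z hz
      have h1 := hx ⟨z, hz⟩
      dsimp only at h1
      rw [SetLike.mem_coe, LinearMap.mem_ker, ← h1, KaehlerDifferential.map_D]
      exact (KaehlerDifferential.D (IntermediateField.adjoin K (Set.range x)) L).map_algebraMap
        ⟨x ⟨z, hz⟩, IntermediateField.subset_adjoin _ _ ⟨_, rfl⟩⟩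
    rw [← Submodule.subsingleton_iff L, ← subsingleton_iff_bot_eq_top,
      ← LinearMap.range_eq_top.2 (KaehlerDifferential.map_surjective K
        (IntermediateField.adjoin K (Set.range x)) L),
      LinearMap.ker_eq_top.1 htop, LinearMap.range_zero]
  have : Algebra.FormallyUnramified (IntermediateField.adjoin K (Set.range x)) L := ⟨hsub⟩
  have : Algebra.IsSeparable (IntermediateField.adjoin K (Set.range x)) L :=
    Algebra.FormallyUnramified.isSeparable (IntermediateField.adjoin K (Set.range x)) L
  have : Algebra.IsAlgebraic (Algebra.adjoin K (Set.range x)) L :=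
    (IsFractionRing.comap_isAlgebraic_iff (K := (IntermediateField.adjoin K (Set.range x)))).2 inferInstance
  refine (Algebra.IsAlgebraic.trdeg_le_cardinalMk K (Set.range x)).trans ?_
  have hbas : Module.Basis b L Ω[L⁄K] := .mk hli (by simp [hspan'])
  rw [Module.finrank_eq_nat_card_basis hbas]
  have : Finite b := Module.Finite.finite_basis hbas
  rw [Nat.cast_card]
  exact Cardinal.mk_range_le

-- In characteristic zero L is separable over K(s) for a transcendence basis s; hence Ω of L over
-- K[s] vanishes and the differentials of s span.
open IntermediateField.algebraAdjoinAdjoin in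
theorem finrank_kaehlerDifferential_le_trdeg (K L : Type) [Field K] [Field L] [CharZero K]
    [Algebra K L] [Algebra.EssFiniteType K L] :
    (Module.finrank L Ω[L⁄K] : Cardinal) ≤ Algebra.trdeg K L := by
  obtain ⟨s, hs⟩ := exists_isTranscendenceBasis K L
  have : Algebra.IsAlgebraic (Algebra.adjoin K s) L := by
    have := hs.isAlgebraic
    rwa [Subtype.range_coe] at this
  have : CharZero (IntermediateField.adjoin K s) :=
    charZero_of_injective_algebraMap (algebraMap K (IntermediateField.adjoin K s)).injective
  have : Algebra.IsAlgebraic (IntermediateField.adjoin K s) L :=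
    (IsFractionRing.comap_isAlgebraic_iff (A := Algebra.adjoin K s)
      (K := (IntermediateField.adjoin K s))).1 inferInstance
  have : Algebra.FormallyUnramified (IntermediateField.adjoin K s) L :=
    .of_isSeparable (IntermediateField.adjoin K s) L
  have : Algebra.FormallyUnramified (Algebra.adjoin K s) (IntermediateField.adjoin K s) :=
    .of_isLocalization (nonZeroDivisors _)
  have : Algebra.FormallyUnramified (Algebra.adjoin K s) L := .comp _ (IntermediateField.adjoin K s) _
  have hspan : Submodule.span L (KaehlerDifferential.D K L '' s) = ⊤ := by
    have h1 : LinearMap.range (KaehlerDifferential.mapBaseChange K (Algebra.adjoin K s) L) = ⊤ := by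
      rw [KaehlerDifferential.range_mapBaseChange, LinearMap.ker_eq_top]
      exact Subsingleton.elim _ _
    have h2 (a : L) (ha : a ∈ Algebra.adjoin K s) : KaehlerDifferential.D K L a ∈
        Submodule.span L (KaehlerDifferential.D K L '' s) := by
      induction ha using Algebra.adjoin_induction with
      | mem x hx => exact Submodule.subset_span ⟨x, hx, rfl⟩
      | algebraMap r => rw [Derivation.map_algebraMap]; exact zero_mem _
      | add x y _ _ hx hy => rw [map_add]; exact add_mem hx hy
      | mul x y _ _ hx hy =>
        rw [Derivation.leibniz]
        exact add_mem (Submodule.smul_mem _ _ hy) (Submodule.smul_mem _ _ hx)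
    have h3 (z : Ω[Algebra.adjoin K s⁄K]) : KaehlerDifferential.map K K (Algebra.adjoin K s) L z ∈
        Submodule.span L (KaehlerDifferential.D K L '' s) := by
      have hz : z ∈ Submodule.span (Algebra.adjoin K s)
          (Set.range (KaehlerDifferential.D K (Algebra.adjoin K s))) := by
        rw [KaehlerDifferential.span_range_derivation]; trivial
      induction hz using Submodule.span_induction with
      | mem x hx =>
        obtain ⟨a, rfl⟩ := hx
        rw [KaehlerDifferential.map_D]
        exact h2 _ a.2
      | zero => rw [map_zero]; exact zero_mem _
      | add x y _ _ hx hy => rw [map_add]; exact add_mem hx hy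
      | smul a x _ hx =>
        rw [map_smul, ← algebraMap_smul L a]
        exact Submodule.smul_mem _ _ hx
    rw [← top_le_iff, ← h1]
    rintro _ ⟨z, rfl⟩
    induction z with
    | zero => rw [map_zero]; exact zero_mem _
    | add x y hx hy => rw [map_add]; exact add_mem hx hy
    | tmul x y =>
      rw [KaehlerDifferential.mapBaseChange_tmul]
      exact Submodule.smul_mem _ _ (h3 y)
  rw [Module.finrank_eq_rank, ← rank_top, ← hspan]
  exact (rank_span_le _).trans (Cardinal.mk_image_le.trans hs.cardinalMk_eq_trdeg.le)

end TrimMaps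

/-! ### Fiber ranks of modules of differentials -/

namespace TrimMaps
open TensorProduct

theorem finrank_tensorProduct_eq_residueField {B L M : Type*} [CommRing B] [Field L] [Algebra B L]
    [AddCommGroup M] [Module B M] (q : Ideal B) [q.IsPrime]
    (hq : RingHom.ker (algebraMap B L) = q) :
    Module.finrank L (L ⊗[B] M) = Module.finrank q.ResidueField (q.Fiber M) := by
  have h1 : q ≤ RingHom.ker (algebraMap B L) := hq.ge
  have h2 : q.primeCompl ≤ (IsUnit.submonoid L).comap (algebraMap B L) := fun x hx =>
    IsUnit.mk0 _ fun h => hx (hq.le h)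
  algebraize [Ideal.ResidueField.lift q (algebraMap B L) h1 h2]
  have : IsScalarTower B q.ResidueField L := .of_algebraMap_eq fun x =>
    (Ideal.ResidueField.lift_algebraMap q (algebraMap B L) h1 h2 x).symm
  rw [← (AlgebraTensorModule.cancelBaseChange B q.ResidueField L L M).finrank_eq,
    Module.finrank_baseChange]

/-- Generic freeness over the domain B/q: M ⊗ B/q becomes free after inverting one element, and
every fiber there has that rank. -/
theorem exists_notMem_finrank_fiber_eq {B M : Type*} [CommRing B] [IsNoetherianRing B]
    [AddCommGroup M] [Module B M] [Module.Finite B M] (q : Ideal B) [q.IsPrime] :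
    ∃ f ∉ q, ∀ (q' : Ideal B) [q'.IsPrime], q ≤ q' → f ∉ q' →
      Module.finrank q'.ResidueField (q'.Fiber M) =
        Module.finrank q.ResidueField (q.Fiber M) := by
  let M' := (B ⧸ q) ⊗[B] M
  have : Module.FinitePresentation (B ⧸ q) M' := Module.finitePresentation_of_finite _ _
  obtain ⟨r, hr, hfree, -⟩ := Module.FinitePresentation.exists_free_localizedModule_powers
    (nonZeroDivisors (B ⧸ q)) (TensorProduct.mk (B ⧸ q) (FractionRing (B ⧸ q)) M' 1)
    (FractionRing (B ⧸ q))
  obtain ⟨f, rfl⟩ := Ideal.Quotient.mk_surjective r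
  let Bf := Localization (Submonoid.powers (Ideal.Quotient.mk q f))
  have hfree' : Module.Free Bf (Bf ⊗[B ⧸ q] M') :=
    .of_equiv (LocalizedModule.equivTensorProduct (Submonoid.powers (Ideal.Quotient.mk q f)) M')
  have key (Q : Ideal B) [Q.IsPrime] (hqQ : q ≤ Q) (hfQ : f ∉ Q) :
      Module.finrank Q.ResidueField (Q.Fiber M) = Module.finrank Bf (Bf ⊗[B ⧸ q] M') := by
    algebraize [Ideal.Quotient.lift q (algebraMap B Q.ResidueField)
      (fun x hx => Ideal.algebraMap_residueField_eq_zero.2 (hqQ hx))]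
    have : IsScalarTower B (B ⧸ q) Q.ResidueField := .of_algebraMap_eq fun x => rfl
    have hunit : IsUnit (algebraMap (B ⧸ q) Q.ResidueField (Ideal.Quotient.mk q f)) :=
      IsUnit.mk0 _ fun h => hfQ (Ideal.algebraMap_residueField_eq_zero.1 h)
    algebraize [IsLocalization.Away.lift (S := Bf) (Ideal.Quotient.mk q f) hunit]
    have : IsScalarTower (B ⧸ q) Bf Q.ResidueField := .of_algebraMap_eq fun x =>
      (IsLocalization.Away.lift_eq (S := Bf) (Ideal.Quotient.mk q f) hunit x).symm
    have : Nontrivial Bf := (algebraMap Bf Q.ResidueField).domain_nontrivial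
    rw [← (AlgebraTensorModule.cancelBaseChange B (B ⧸ q) Q.ResidueField Q.ResidueField M).finrank_eq,
      ← (AlgebraTensorModule.cancelBaseChange (B ⧸ q) Bf Q.ResidueField Q.ResidueField M').finrank_eq,
      Module.finrank_baseChange]
  have hfq : f ∉ q := fun h => nonZeroDivisors.ne_zero hr (Ideal.Quotient.eq_zero_iff_mem.2 h)
  exact ⟨f, hfq, fun q' _ hqq' hf => (key q' hqq' hf).trans (key q le_rfl hfq).symm⟩

theorem trdeg_fractionRing (k R K : Type) [Field k] [CommRing R] [IsDomain R] [Algebra k R] [Field K]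
    [Algebra R K] [Algebra k K] [IsScalarTower k R K] [IsFractionRing R K] :
    Algebra.trdeg k K = Algebra.trdeg k R := by
  have : Algebra.IsAlgebraic R K := IsLocalization.isAlgebraic _ (nonZeroDivisors R)
  have h := trdeg_add_eq k R (A := K)
  rw [trdeg_eq_zero (R := R), add_zero] at h
  exact h.symm

/-- The difference of the dimensions is the transcendence degree of κ(q)/κ(p). It is bounded by the
dimension of Ω of this extension, which is a quotient of κ(q) ⊗ Ω[B⁄A]. -/
theorem ringKrullDim_quotient_le_add_finrank (k : Type) {A B : Type} [Field k] [CommRing A]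
    [CommRing B] [Algebra k A] [Algebra k B] [Algebra A B] [IsScalarTower k A B]
    [Algebra.FiniteType k A] [Algebra.FiniteType k B] (p : Ideal A) (q : Ideal B) [p.IsPrime]
    [q.IsPrime] (hpq : q.comap (algebraMap A B) = p) :
    ringKrullDim (B ⧸ q) ≤ ringKrullDim (A ⧸ p) +
      (Module.finrank q.ResidueField (q.Fiber Ω[B⁄A]) : WithBot ℕ∞) := by
  have : Algebra.FiniteType A B := .of_restrictScalars_finiteType k A B
  have hl : q.LiesOver p := ⟨hpq.symm⟩
  have : Algebra.EssFiniteType A q.ResidueField := .comp A B _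
  algebraize [Ideal.ResidueField.map p q (algebraMap A B) hpq.symm]
  have : IsScalarTower A p.ResidueField q.ResidueField := .of_algebraMap_eq fun x => by
    rw [IsScalarTower.algebraMap_apply A B q.ResidueField]
    exact (Ideal.ResidueField.map_algebraMap p q (algebraMap A B) hpq.symm x).symm
  have : IsScalarTower k p.ResidueField q.ResidueField := .of_algebraMap_eq fun x => by
    rw [IsScalarTower.algebraMap_apply k A q.ResidueField,
      IsScalarTower.algebraMap_apply k A p.ResidueField,
      ← IsScalarTower.algebraMap_apply A p.ResidueField q.ResidueField]
  have : Algebra.EssFiniteType p.ResidueField q.ResidueField := .of_comp A _ _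
  have h1 := trdeg_add_eq k p.ResidueField (A := q.ResidueField)
  rw [trdeg_fractionRing k (A ⧸ p), trdeg_fractionRing k (B ⧸ q)] at h1
  have h2 := trdeg_le_finrank_kaehlerDifferential p.ResidueField q.ResidueField
  have : Algebra.FormallyUnramified B (B ⧸ q) :=
    .of_surjective (Algebra.ofId B (B ⧸ q)) Ideal.Quotient.mk_surjective
  have : Algebra.FormallyUnramified (B ⧸ q) q.ResidueField :=
    .of_isLocalization (nonZeroDivisors _)
  have : Algebra.FormallyUnramified B q.ResidueField := .comp _ (B ⧸ q) _
  -- B → κ(q) is a quotient followed by a localization, hence unramified, so the differentials of B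
  -- generate.
  have h3 : Module.finrank q.ResidueField Ω[q.ResidueField⁄p.ResidueField] ≤
      Module.finrank q.ResidueField (q.Fiber Ω[B⁄A]) := by
    refine (LinearMap.finrank_le_finrank_of_surjective
      (KaehlerDifferential.map_surjective A p.ResidueField q.ResidueField)).trans
      (LinearMap.finrank_le_finrank_of_surjective
        (f := KaehlerDifferential.mapBaseChange A B q.ResidueField) ?_)
    rw [← LinearMap.range_eq_top, KaehlerDifferential.range_mapBaseChange, LinearMap.ker_eq_top]
    exact Subsingleton.elim _ _
  rw [ringKrullDim_eq_trdeg k (A ⧸ p), ringKrullDim_eq_trdeg k (B ⧸ q), ← h1]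
  have h4 : Algebra.trdeg p.ResidueField q.ResidueField < Cardinal.aleph0 :=
    h2.trans_lt (Cardinal.natCast_lt_aleph0)
  rw [Cardinal.toNat_add trdeg_lt_aleph0_of_finiteType h4]
  have h5 := Cardinal.toNat_le_toNat h2 Cardinal.natCast_lt_aleph0
  rw [Cardinal.toNat_natCast] at h5
  exact_mod_cast Nat.add_le_add_left (h5.trans h3) _

/-- A projective Ω has the same rank at q as at the generic point, where it is bounded by the
transcendence degree of the function field. -/
theorem finrank_fiber_kaehlerDifferential_le {k B : Type} [Field k] [CharZero k] [CommRing B]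
    [IsDomain B] [Algebra k B] [Algebra.FiniteType k B] [Module.Projective B Ω[B⁄k]]
    (q : Ideal B) [q.IsPrime] :
    (Module.finrank q.ResidueField (q.Fiber Ω[B⁄k]) : WithBot ℕ∞) ≤ ringKrullDim B := by
  have h1 : Module.finrank q.ResidueField (q.Fiber Ω[B⁄k]) = Module.finrank B Ω[B⁄k] :=
    Ideal.finrank_fiber_eq_finrank q
  have : Algebra.FormallyEtale B (FractionRing B) := .of_isLocalization (nonZeroDivisors B)
  have h2 : Module.finrank B Ω[B⁄k] =
      Module.finrank (FractionRing B) Ω[FractionRing B⁄k] :=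
    ((KaehlerDifferential.isBaseChange_of_formallyEtale k B (FractionRing B)).finrank_eq).symm
  have : Algebra.EssFiniteType B (FractionRing B) := .of_isLocalization _ (nonZeroDivisors B)
  have : Algebra.EssFiniteType k (FractionRing B) := .comp k B _
  have h3 := finrank_kaehlerDifferential_le_trdeg k (FractionRing B)
  rw [trdeg_fractionRing k B] at h3
  rw [h1, h2, ringKrullDim_eq_trdeg k B]
  have h4 := Cardinal.toNat_le_toNat h3 trdeg_lt_aleph0_of_finiteType
  rw [Cardinal.toNat_natCast] at h4
  exact_mod_cast h4

end TrimMaps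

/-! ### Affine charts and the dimension of a scheme point -/

namespace TrimMaps
open TensorProduct

/-- The structure map `ℂ → Γ(X, U)` of a scheme over `ℂ`. -/
noncomputable def sectionStructureHom (X : Scheme.{0}) [X.Over SpecC] (U : X.Opens) :
    ℂ →+* Γ(X, U) :=
  ((Scheme.ΓSpecIso (CommRingCat.of ℂ)).inv ≫ (X ↘ SpecC).appTop ≫
    X.presheaf.map (homOfLE le_top).op).hom

noncomputable instance (X : Scheme.{0}) [X.Over SpecC] (U : X.Opens) : Algebra ℂ Γ(X, U) :=
  (sectionStructureHom X U).toAlgebra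

theorem germ_comp_sectionStructureHom (X : Scheme.{0}) [X.Over SpecC] (U : X.Opens) (x : X)
    (hx : x ∈ U) :
    (X.presheaf.germ U x hx).hom.comp (sectionStructureHom X U) = stalkStructureHom X x := by
  unfold sectionStructureHom stalkStructureHom
  rw [← CommRingCat.hom_comp, Category.assoc, Category.assoc, TopCat.Presheaf.germ_res]

theorem appLE_comp_sectionStructureHom {Y S : Scheme.{0}} [Y.Over SpecC] [S.Over SpecC]
    (π : Y ⟶ S) [π.IsOver SpecC] {U : S.Opens} {V : Y.Opens} (e : V ≤ π ⁻¹ᵁ U) :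
    (π.appLE U V e).hom.comp (sectionStructureHom S U) = sectionStructureHom Y V := by
  unfold sectionStructureHom
  have h : (Y ↘ SpecC).appTop = (S ↘ SpecC).appTop ≫ π.appTop := by
    rw [← Scheme.Hom.comp_appTop, comp_over π SpecC]
  rw [← CommRingCat.hom_comp, Category.assoc, Category.assoc, Scheme.Hom.map_appLE, h,
    Category.assoc]
  rfl

theorem finiteType_section {X : Scheme.{0}} [X.Over SpecC] [IsVariety X] {U : X.Opens}
    (hU : IsAffineOpen U) : Algebra.FiniteType ℂ Γ(X, U) := by
  have := IsVariety.locallyOfFiniteType (X := X)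
  have h := (X ↘ SpecC).finiteType_appLE (isAffineOpen_top _) hU le_top
  exact h.comp (.of_surjective _
    (ConcreteCategory.bijective_of_isIso (Scheme.ΓSpecIso (CommRingCat.of ℂ)).inv).2)

theorem smooth_section {X : Scheme.{0}} [X.Over SpecC] (hX : IsNonsingular X) {U : X.Opens}
    (hU : IsAffineOpen U) : Algebra.Smooth ℂ Γ(X, U) := by
  have : Smooth (X ↘ SpecC) := hX
  have h := (X ↘ SpecC).smooth_appLE (isAffineOpen_top _) hU le_top
  exact RingHom.Smooth.comp (.of_bijective
    (ConcreteCategory.bijective_of_isIso (Scheme.ΓSpecIso (CommRingCat.of ℂ)).inv)) h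

section stalk

variable {X : Scheme.{0}} {U : X.Opens} (hU : IsAffineOpen U) (x : X) (hx : x ∈ U)
include hU

theorem ker_evaluation : RingHom.ker (X.evaluation U x hx).hom = (hU.primeIdealOf ⟨x, hx⟩).asIdeal := by
  rw [hU.primeIdealOf_eq_map_closedPoint]
  ext a
  change X.residue x (X.presheaf.germ U x hx a) = 0 ↔
    X.presheaf.germ U x hx a ∈ IsLocalRing.maximalIdeal (X.presheaf.stalk x)
  exact IsLocalRing.residue_eq_zero_iff _

theorem exists_evaluation_mul_eq (z : X.residueField x) : ∃ a b : Γ(X, U),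
    X.evaluation U x hx b ≠ 0 ∧ z * X.evaluation U x hx b = X.evaluation U x hx a := by
  obtain ⟨t, rfl⟩ := X.residue_surjective x z
  let := X.presheaf.algebra_section_stalk ⟨x, hx⟩
  have := hU.isLocalization_stalk ⟨x, hx⟩
  obtain ⟨⟨a, b⟩, hab⟩ := IsLocalization.surj (hU.primeIdealOf ⟨x, hx⟩).asIdeal.primeCompl t
  refine ⟨a, b, fun h => b.2 ?_, ?_⟩
  · exact (ker_evaluation hU x hx).le h
  · exact ((map_mul (X.residue x).hom _ _).symm.trans (congrArg (X.residue x).hom hab))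

end stalk

/-- The transcendence degree over `ℂ` of the residue field at a point of a complex scheme. -/
noncomputable def pointDim (X : Scheme.{0}) [X.Over SpecC] (x : X) : ℕ :=
  letI : Algebra ℂ (X.residueField x) :=
    ((X.residue x).hom.comp (stalkStructureHom X x)).toAlgebra
  Cardinal.toNat (Algebra.trdeg ℂ (X.residueField x))

/-- The residue field is the fraction field of the quotient, so `pointDim` can be read off in any
affine chart. -/
theorem ringKrullDim_quotient_primeIdealOf {X : Scheme.{0}} [X.Over SpecC] [IsVariety X]
    {U : X.Opens} (hU : IsAffineOpen U) (x : X) (hx : x ∈ U) :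
    ringKrullDim (Γ(X, U) ⧸ (hU.primeIdealOf ⟨x, hx⟩).asIdeal) = (pointDim X x : WithBot ℕ∞) := by
  have := finiteType_section hU
  let p := (hU.primeIdealOf ⟨x, hx⟩).asIdeal
  let : Algebra ℂ (X.residueField x) :=
    ((X.residue x).hom.comp (stalkStructureHom X x)).toAlgebra
  have hker : RingHom.ker (X.evaluation U x hx).hom = p := ker_evaluation hU x hx
  algebraize [Ideal.Quotient.lift p (X.evaluation U x hx).hom (fun a ha => hker.ge ha)]
  have : IsScalarTower ℂ (Γ(X, U) ⧸ p) (X.residueField x) := .of_algebraMap_eq' (by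
    change (X.residue x).hom.comp (stalkStructureHom X x) =
      (X.evaluation U x hx).hom.comp (sectionStructureHom X U)
    rw [← germ_comp_sectionStructureHom X U x hx]
    rfl)
  have : FaithfulSMul (Γ(X, U) ⧸ p) (X.residueField x) := by
    rw [faithfulSMul_iff_algebraMap_injective]
    exact RingHom.lift_injective_of_ker_le_ideal _ _ hker.le
  have : IsFractionRing (Γ(X, U) ⧸ p) (X.residueField x) := .of_field _ _ fun z => by
    obtain ⟨a, b, hb, hab⟩ := exists_evaluation_mul_eq hU x hx z
    exact ⟨Ideal.Quotient.mk p a, Ideal.Quotient.mk p b, eq_div_of_mul_eq hb hab⟩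
  rw [ringKrullDim_eq_trdeg ℂ, ← trdeg_fractionRing ℂ (Γ(X, U) ⧸ p) (X.residueField x)]
  rfl

end TrimMaps

/-! ### Topological dimension through dimensions of points -/

namespace TrimMaps
open TopologicalSpace

theorem quasiSober_of_isLocallyClosed {X : Type*} [TopologicalSpace X] [QuasiSober X] {Z : Set X}
    (hZ : IsLocallyClosed Z) : QuasiSober Z := by
  obtain ⟨O, C, hO, hC, rfl⟩ := hZ
  have : QuasiSober O := hO.isOpenEmbedding_subtypeVal.quasiSober
  have h : Topology.IsClosedEmbedding (Set.inclusion (Set.inter_subset_left : O ∩ C ⊆ O)) := by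
    refine ⟨Topology.IsEmbedding.inclusion _, ?_⟩
    rw [Set.range_inclusion]
    convert! hC.preimage (continuous_subtype_val : Continuous ((↑) : O → X)) using 1
    ext x
    simp
  exact h.quasiSober

theorem specializes_iff_primeIdealOf_le {X : Scheme.{0}} {U : X.Opens} (hU : IsAffineOpen U)
    {x y : X} (hx : x ∈ U) (hy : y ∈ U) :
    x ⤳ y ↔ hU.primeIdealOf ⟨x, hx⟩ ≤ hU.primeIdealOf ⟨y, hy⟩ := by
  have h := hU.fromSpec.isOpenEmbedding.isInducing.specializes_iff
    (x := hU.primeIdealOf ⟨x, hx⟩) (y := hU.primeIdealOf ⟨y, hy⟩)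
  rw [hU.fromSpec_primeIdealOf, hU.fromSpec_primeIdealOf] at h
  exact h.trans (PrimeSpectrum.le_iff_specializes _ _).symm

theorem fromSpec_mem {X : Scheme.{0}} {U : X.Opens} (hU : IsAffineOpen U)
    (p : PrimeSpectrum Γ(X, U)) : hU.fromSpec p ∈ U := by
  have : hU.fromSpec p ∈ Set.range hU.fromSpec := ⟨p, rfl⟩
  rwa [hU.range_fromSpec] at this

theorem primeIdealOf_fromSpec {X : Scheme.{0}} {U : X.Opens} (hU : IsAffineOpen U)
    (p : PrimeSpectrum Γ(X, U)) : hU.primeIdealOf ⟨hU.fromSpec p, fromSpec_mem hU p⟩ = p :=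
  hU.fromSpec.isOpenEmbedding.injective (hU.fromSpec_primeIdealOf _)

theorem ringKrullDim_quotient_asIdeal {X : Scheme.{0}} [X.Over SpecC] [IsVariety X] {U : X.Opens}
    (hU : IsAffineOpen U) (p : PrimeSpectrum Γ(X, U)) :
    ringKrullDim (Γ(X, U) ⧸ p.asIdeal) = (pointDim X (hU.fromSpec p) : WithBot ℕ∞) := by
  have h := ringKrullDim_quotient_primeIdealOf hU _ (fromSpec_mem hU p)
  rwa [primeIdealOf_fromSpec] at h

/-- A chart containing the generic point of the smallest member of the chain contains the generic
points of all of them, since these specialize to it. -/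
theorem exists_ltSeries_primeSpectrum {X : Scheme.{0}} {Z : Set X} (hZ : IsLocallyClosed Z)
    {ι : Type*} {V : ι → X.Opens} (hV : ∀ i, IsAffineOpen (V i)) (hcov : ∀ z ∈ Z, ∃ i, z ∈ V i)
    (l : LTSeries (IrreducibleCloseds Z)) :
    ∃ i, ∃ l' : LTSeries {p : PrimeSpectrum Γ(X, V i) | (hV i).fromSpec p ∈ Z},
      l'.length = l.length := by
  have := quasiSober_of_isLocallyClosed hZ
  let e (C : IrreducibleCloseds Z) : Z := C.2.genericPoint
  have he (C : IrreducibleCloseds Z) : closure {e C} = (C : Set Z) := by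
    rw [C.2.genericPoint_closure_eq]
    exact C.3.closure_eq
  obtain ⟨i, hi⟩ := hcov _ (e l.head).2
  have hspec (a b : Fin (l.length + 1)) : (e (l b)).1 ⤳ (e (l a)).1 ↔ l a ≤ l b := by
    rw [← subtype_specializes_iff, specializes_iff_closure_subset, he, he]
    rfl
  have hmem (a : Fin (l.length + 1)) : (e (l a)).1 ∈ V i :=
    ((hspec 0 a).2 (l.monotone (Fin.zero_le a))).mem_open (V i).2 hi
  -- Larger closed sets correspond to smaller primes, hence the reversed indices.
  refine ⟨i, ⟨l.length, fun j => ⟨(hV i).primeIdealOf ⟨_, hmem j.rev⟩, ?_⟩, fun j => ?_⟩, rfl⟩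
  · rw [Set.mem_ofPred_eq, IsAffineOpen.fromSpec_primeIdealOf]
    exact (e (l j.rev)).2
  · have h1 : l j.succ.rev < l j.castSucc.rev := l.strictMono (by simp)
    change (hV i).primeIdealOf _ < (hV i).primeIdealOf _
    rw [lt_iff_le_not_ge, ← specializes_iff_primeIdealOf_le, ← specializes_iff_primeIdealOf_le,
      hspec, hspec]
    exact lt_iff_le_not_ge.1 h1

theorem exists_length_le_pointDim {X : Scheme.{0}} [X.Over SpecC] [IsVariety X] {Z : Set X}
    (hZ : IsLocallyClosed Z) (l : LTSeries (IrreducibleCloseds Z)) :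
    ∃ z ∈ Z, l.length ≤ pointDim X z := by
  obtain ⟨U, l', hl'⟩ := exists_ltSeries_primeSpectrum hZ (V := fun U : X.affineOpens => U.1)
    (fun U => U.2) (fun z _ => by
      obtain ⟨U, hU, hz, -⟩ := exists_isAffineOpen_mem_and_subset (Opens.mem_top z)
      exact ⟨⟨U, hU⟩, hz⟩) l
  let p := l'.head.1
  refine ⟨U.2.fromSpec p, l'.head.2, ?_⟩
  have h1 := ringKrullDim_quotient_asIdeal U.2 p
  rw [ringKrullDim_quotient] at h1
  let m : LTSeries (PrimeSpectrum.zeroLocus (p.asIdeal : Set Γ(X, U.1))) :=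
    ⟨l'.length, fun j => ⟨(l' j).1, l'.head_le j⟩, fun j => l'.step j⟩
  have h2 := Order.LTSeries.length_le_krullDim m
  rw [h1] at h2
  rw [← hl']
  exact_mod_cast h2

/-- The closure of x minus the zeros of f is the spectrum of a localized domain with unchanged
transcendence degree, and it embeds topologically in T. -/
theorem pointDim_le_topologicalKrullDim {X : Scheme.{0}} [X.Over SpecC] [IsVariety X]
    {U : X.Opens} (hU : IsAffineOpen U) (x : X) (hx : x ∈ U) (f : Γ(X, U))
    (hf : f ∉ (hU.primeIdealOf ⟨x, hx⟩).asIdeal) (T : Set X)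
    (hT : ∀ p : PrimeSpectrum Γ(X, U), hU.primeIdealOf ⟨x, hx⟩ ≤ p → f ∉ p.asIdeal →
      hU.fromSpec p ∈ T) : (pointDim X x : WithBot ℕ∞) ≤ topologicalKrullDim T := by
  let P := hU.primeIdealOf ⟨x, hx⟩
  let R := Γ(X, U) ⧸ P.asIdeal
  let f' : R := Ideal.Quotient.mk P.asIdeal f
  let Rf := Localization.Away f'
  have := finiteType_section hU
  have hf0 : f' ≠ 0 := fun h => hf (Ideal.Quotient.eq_zero_iff_mem.1 h)
  have hle : Submonoid.powers f' ≤ nonZeroDivisors R :=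
    powers_le_nonZeroDivisors_of_noZeroDivisors hf0
  have : IsDomain Rf := IsLocalization.isDomain_localization hle
  have : Algebra.FiniteType ℂ Rf := .trans (S := R) inferInstance inferInstance
  have hdim : ringKrullDim Rf = (pointDim X x : WithBot ℕ∞) := by
    rw [← ringKrullDim_quotient_primeIdealOf hU x hx, ringKrullDim_eq_trdeg ℂ,
      ringKrullDim_eq_trdeg ℂ]
    have : FaithfulSMul R Rf :=
      (faithfulSMul_iff_algebraMap_injective _ _).2 (IsLocalization.injective _ hle)
    have : Algebra.IsAlgebraic R Rf := IsLocalization.isAlgebraic _ (Submonoid.powers f')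
    have h := trdeg_add_eq ℂ R (A := Rf)
    rw [trdeg_eq_zero (R := R), add_zero] at h
    rw [← h]
  rw [← hdim, ← PrimeSpectrum.topologicalKrullDim_eq_ringKrullDim]
  let g : PrimeSpectrum Rf → X := fun q => hU.fromSpec
    (PrimeSpectrum.comap (Ideal.Quotient.mk P.asIdeal) (PrimeSpectrum.comap (algebraMap R Rf) q))
  have hg : Topology.IsInducing g :=
    hU.fromSpec.isOpenEmbedding.isInducing.comp
      ((PrimeSpectrum.isClosedEmbedding_comap_of_surjective _ _
        Ideal.Quotient.mk_surjective).isInducing.comp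
        (PrimeSpectrum.localization_comap_isInducing Rf (Submonoid.powers f')))
  have hgT (q) : g q ∈ T := by
    refine hT _ ?_ ?_
    · intro a ha
      change algebraMap R Rf (Ideal.Quotient.mk P.asIdeal a) ∈ q.asIdeal
      rw [Ideal.Quotient.eq_zero_iff_mem.2 ha, map_zero]
      exact zero_mem _
    · intro h
      exact q.2.ne_top (Ideal.eq_top_of_isUnit_mem _ h (IsLocalization.Away.algebraMap_isUnit f'))
  exact (hg.codRestrict hgT).topologicalKrullDim_le

theorem pointDim_lt_of_specializes {X : Scheme.{0}} [X.Over SpecC] [IsVariety X] {x y : X}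
    (h : x ⤳ y) (hne : x ≠ y) : pointDim X y < pointDim X x := by
  obtain ⟨U, hU, hy, -⟩ := exists_isAffineOpen_mem_and_subset (Opens.mem_top y)
  have hx := h.mem_open U.2 hy
  have hle := (specializes_iff_primeIdealOf_le hU hx hy).1 h
  have hlt : hU.primeIdealOf ⟨x, hx⟩ < hU.primeIdealOf ⟨y, hy⟩ :=
    lt_of_le_of_ne hle fun he => hne <|
      (hU.fromSpec_primeIdealOf ⟨x, hx⟩).symm.trans ((congrArg hU.fromSpec he).trans
        (hU.fromSpec_primeIdealOf ⟨y, hy⟩))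
  obtain ⟨-, a, ha, hax⟩ := SetLike.lt_iff_le_and_exists.1
    (show (hU.primeIdealOf ⟨x, hx⟩).asIdeal < (hU.primeIdealOf ⟨y, hy⟩).asIdeal from hlt)
  have h1 := ringKrullDim_succ_le_of_surjective (Ideal.Quotient.factor hle)
    (Ideal.Quotient.factor_surjective hle) (r := Ideal.Quotient.mk _ a)
    (mem_nonZeroDivisors_of_ne_zero fun h => hax (Ideal.Quotient.eq_zero_iff_mem.1 h))
    (by rw [Ideal.Quotient.factor_mk]; exact Ideal.Quotient.eq_zero_iff_mem.2 ha)
  rw [ringKrullDim_quotient_primeIdealOf, ringKrullDim_quotient_primeIdealOf] at h1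
  exact_mod_cast h1

end TrimMaps

/-! ### The rank of the differential in affine charts -/

namespace TrimMaps
open TopologicalSpace TensorProduct

theorem differentialRank_add_finrank {Y S : Scheme.{0}} [Y.Over SpecC] [S.Over SpecC]
    [IsVariety Y] (π : Y ⟶ S) [π.IsOver SpecC] {U : S.Opens} (hU : IsAffineOpen U) {V : Y.Opens}
    (hV : IsAffineOpen V) (e : V ≤ π ⁻¹ᵁ U) (y : Y) (hy : y ∈ V) :
    letI := (π.appLE U V e).hom.toAlgebra
    letI q := (hV.primeIdealOf ⟨y, hy⟩).asIdeal
    differentialRank π y + Module.finrank q.ResidueField (q.Fiber Ω[Γ(Y, V)⁄Γ(S, U)]) =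
      Module.finrank q.ResidueField (q.Fiber Ω[Γ(Y, V)⁄ℂ]) := by
  have hs : π y ∈ U := e hy
  let i1 : Algebra Γ(S, U) Γ(Y, V) := (π.appLE U V e).hom.toAlgebra
  let q := (hV.primeIdealOf ⟨y, hy⟩).asIdeal
  change differentialRank π y + Module.finrank q.ResidueField (q.Fiber Ω[Γ(Y, V)⁄Γ(S, U)]) =
      Module.finrank q.ResidueField (q.Fiber Ω[Γ(Y, V)⁄ℂ])
  let i2 : Algebra Γ(Y, V) (Y.residueField y) := (Y.evaluation V y hy).hom.toAlgebra
  have hker : RingHom.ker (algebraMap Γ(Y, V) (Y.residueField y)) = q := ker_evaluation hV y hy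
  rw [← finrank_tensorProduct_eq_residueField q hker, ← finrank_tensorProduct_eq_residueField q hker]
  unfold differentialRank
  let i3 : Algebra ℂ (S.presheaf.stalk (π y)) := (stalkStructureHom S (π y)).toAlgebra
  let i4 : Algebra ℂ (Y.presheaf.stalk y) := (stalkStructureHom Y y).toAlgebra
  let i5 : Algebra (S.presheaf.stalk (π y)) (Y.presheaf.stalk y) := (π.stalkMap y).hom.toAlgebra
  let i6 : Algebra (Y.presheaf.stalk y) (Y.residueField y) := (Y.residue y).hom.toAlgebra
  let i7 : Algebra ℂ (Y.residueField y) :=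
    ((Y.residue y).hom.comp (stalkStructureHom Y y)).toAlgebra
  let i8 : Algebra (S.presheaf.stalk (π y)) (Y.residueField y) :=
    ((Y.residue y).hom.comp (π.stalkMap y).hom).toAlgebra
  have t1 : IsScalarTower ℂ (S.presheaf.stalk (π y)) (Y.presheaf.stalk y) :=
    .of_algebraMap_eq' (stalkMap_comp_stalkStructureHom π y).symm
  have t2 : IsScalarTower ℂ (Y.presheaf.stalk y) (Y.residueField y) := .of_algebraMap_eq' rfl
  have t3 : IsScalarTower (S.presheaf.stalk (π y)) (Y.presheaf.stalk y) (Y.residueField y) :=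
    .of_algebraMap_eq' rfl
  have t4 : IsScalarTower ℂ (S.presheaf.stalk (π y)) (Y.residueField y) :=
    .of_algebraMap_eq' (congrArg (Y.residue y).hom.comp
      (stalkMap_comp_stalkStructureHom π y).symm)
  let j1 : Algebra Γ(S, U) (S.presheaf.stalk (π y)) := S.presheaf.algebra_section_stalk ⟨π y, hs⟩
  let j2 : Algebra Γ(Y, V) (Y.presheaf.stalk y) := Y.presheaf.algebra_section_stalk ⟨y, hy⟩
  let j3 : Algebra Γ(S, U) (Y.presheaf.stalk y) :=
    ((π.stalkMap y).hom.comp (S.presheaf.germ U (π y) hs).hom).toAlgebra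
  let j4 : Algebra Γ(S, U) (Y.residueField y) :=
    ((Y.residue y).hom.comp
      ((π.stalkMap y).hom.comp (S.presheaf.germ U (π y) hs).hom)).toAlgebra
  -- The two routes from Γ(S, U) to the stalk at y agree; the remaining tower compatibilities over
  -- Γ(S, U) and Γ(Y, V) rest on this.
  have hgerm : (π.stalkMap y).hom.comp (S.presheaf.germ U (π y) hs).hom =
      (Y.presheaf.germ V y hy).hom.comp (π.appLE U V e).hom := by
    have h1 : S.presheaf.germ U (π y) hs ≫ π.stalkMap y =
        π.appLE U V e ≫ Y.presheaf.germ V y hy := by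
      rw [Scheme.Hom.germ_stalkMap, Scheme.Hom.appLE, Category.assoc, TopCat.Presheaf.germ_res]
    exact congrArg CommRingCat.Hom.hom h1
  have s1 : IsScalarTower ℂ Γ(S, U) Γ(Y, V) :=
    .of_algebraMap_eq' (appLE_comp_sectionStructureHom π e).symm
  have s2 : IsScalarTower Γ(S, U) Γ(Y, V) (Y.presheaf.stalk y) := .of_algebraMap_eq' hgerm
  have s3 : IsScalarTower Γ(S, U) Γ(Y, V) (Y.residueField y) :=
    .of_algebraMap_eq' (congrArg (Y.residue y).hom.comp hgerm)
  have s4 : IsScalarTower Γ(S, U) (S.presheaf.stalk (π y)) (Y.presheaf.stalk y) :=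
    .of_algebraMap_eq' rfl
  have s5 : IsScalarTower Γ(S, U) (S.presheaf.stalk (π y)) (Y.residueField y) :=
    .of_algebraMap_eq' rfl
  have s6 : IsScalarTower Γ(Y, V) (Y.presheaf.stalk y) (Y.residueField y) :=
    .of_algebraMap_eq' rfl
  have s7 : IsScalarTower ℂ Γ(S, U) (S.presheaf.stalk (π y)) :=
    .of_algebraMap_eq' (germ_comp_sectionStructureHom S U (π y) hs).symm
  have s8 : IsScalarTower ℂ Γ(Y, V) (Y.presheaf.stalk y) :=
    .of_algebraMap_eq' (germ_comp_sectionStructureHom Y V y hy).symm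
  have s9 : IsScalarTower ℂ Γ(Y, V) (Y.residueField y) :=
    .of_algebraMap_eq' (congrArg (Y.residue y).hom.comp
      (germ_comp_sectionStructureHom Y V y hy).symm)
  have s10 : IsScalarTower ℂ Γ(S, U) (Y.residueField y) := by
    refine .of_algebraMap_eq' ?_
    rw [IsScalarTower.algebraMap_eq ℂ (S.presheaf.stalk (π y)) (Y.residueField y),
      IsScalarTower.algebraMap_eq ℂ Γ(S, U) (S.presheaf.stalk (π y)), ← RingHom.comp_assoc,
      ← IsScalarTower.algebraMap_eq]
  have l1 : IsLocalization (hU.primeIdealOf ⟨π y, hs⟩).asIdeal.primeCompl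
    (S.presheaf.stalk (π y)) := hU.isLocalization_stalk ⟨π y, hs⟩
  have l2 : IsLocalization (hV.primeIdealOf ⟨y, hy⟩).asIdeal.primeCompl
    (Y.presheaf.stalk y) := hV.isLocalization_stalk ⟨y, hy⟩
  have := finiteType_section hV
  exact finrank_range_derivationPullback_localization_add ℂ Γ(S, U) Γ(Y, V)
    (S.presheaf.stalk (π y)) (Y.presheaf.stalk y) (Y.residueField y)
    (hU.primeIdealOf ⟨π y, hs⟩).asIdeal.primeCompl
    (hV.primeIdealOf ⟨y, hy⟩).asIdeal.primeCompl

end TrimMaps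

/-! ### From fibers over closed points to points over z -/

namespace TrimMaps
open TopologicalSpace

theorem comap_appLE_eq_primeIdealOf {Y S : Scheme.{0}} (π : Y ⟶ S) {U : S.Opens}
    (hU : IsAffineOpen U) {V : Y.Opens} (hV : IsAffineOpen V) (e : V ≤ π ⁻¹ᵁ U)
    (p : PrimeSpectrum Γ(Y, V)) :
    p.comap (π.appLE U V e).hom = hU.primeIdealOf ⟨π (hV.fromSpec p), e (fromSpec_mem hV p)⟩ := by
  have h := IsAffineOpen.comap_primeIdealOf_appLE U hU V hV e (fromSpec_mem hV p)
  rwa [primeIdealOf_fromSpec] at h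

theorem primeIdealOf_injective {X : Scheme.{0}} {U : X.Opens} (hU : IsAffineOpen U) {x y : U}
    (h : hU.primeIdealOf x = hU.primeIdealOf y) : x = y :=
  Subtype.ext <| (hU.fromSpec_primeIdealOf x).symm.trans
    ((congrArg hU.fromSpec h).trans (hU.fromSpec_primeIdealOf y))

section

variable {Y S : Scheme.{0}} [Y.Over SpecC] [S.Over SpecC] [IsVariety Y] [IsVariety S] (π : Y ⟶ S)
  [π.IsOver SpecC]

theorem exists_notMem_length_fiber_add_le_pointDim {U : S.Opens} (hU : IsAffineOpen U)
    {V : Y.Opens} (hV : IsAffineOpen V) (e : V ≤ π ⁻¹ᵁ U) (z : S) (hz : z ∈ U) :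
    ∃ f ∉ (hU.primeIdealOf ⟨z, hz⟩).asIdeal, ∀ (t : S) (ht : t ∈ U), z ⤳ t →
      f ∉ (hU.primeIdealOf ⟨t, ht⟩).asIdeal →
      ∀ l : LTSeries {p : PrimeSpectrum Γ(Y, V) | hV.fromSpec p ∈ π ⁻¹' {t}},
        ∃ w, π w = z ∧ pointDim S z + l.length ≤ pointDim Y w := by
  algebraize [(π.appLE U V e).hom]
  have : IsScalarTower ℂ Γ(S, U) Γ(Y, V) :=
    .of_algebraMap_eq' (appLE_comp_sectionStructureHom π e).symm
  have := finiteType_section hU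
  have := finiteType_section hV
  obtain ⟨f, hf, H⟩ := exists_notMem_length_fiber_add_le (k := ℂ) (B := Γ(Y, V))
    (hU.primeIdealOf ⟨z, hz⟩).asIdeal
  refine ⟨f, hf, fun t ht hzt hft l => ?_⟩
  have hl (j) : PrimeSpectrum.comap (algebraMap Γ(S, U) Γ(Y, V)) (l j).1 =
      hU.primeIdealOf ⟨t, ht⟩ :=
    (comap_appLE_eq_primeIdealOf π hU hV e (l j).1).trans
      (congrArg hU.primeIdealOf (Subtype.ext (l j).2))
  obtain ⟨q, hq, hqz, hle⟩ := H (hU.primeIdealOf ⟨t, ht⟩)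
    ((specializes_iff_primeIdealOf_le hU hz ht).1 hzt) hft
    ⟨l.length, fun j => ⟨(l j).1, hl j⟩, fun j => l.step j⟩
  let w := hV.fromSpec ⟨q, hq⟩
  refine ⟨w, ?_, ?_⟩
  · have h1 := comap_appLE_eq_primeIdealOf π hU hV e ⟨q, hq⟩
    have h2 : PrimeSpectrum.comap (π.appLE U V e).hom ⟨q, hq⟩ = hU.primeIdealOf ⟨z, hz⟩ :=
      PrimeSpectrum.ext hqz
    exact congrArg Subtype.val (primeIdealOf_injective hU (h1.symm.trans h2))
  · rw [ringKrullDim_quotient_primeIdealOf hU,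
      ringKrullDim_quotient_asIdeal hV ⟨q, hq⟩] at hle
    exact_mod_cast hle

/-- Fiber dimensions are prescribed only over closed points, while z is arbitrary. A general closed
point of Z in the closure of z has a fiber of dimension d, and a chain of length d in it is
transferred to a point over z. -/
theorem exists_pointDim_add_le_of_hasFiberDim [IsProper π] {Z : Set S} (hZ : IsLocallyClosed Z)
    {d : ℕ} (hd : HasFiberDim π Z d) {z : S} (hz : z ∈ Z) :
    ∃ w, π w = z ∧ pointDim S z + d ≤ pointDim Y w := by
  obtain ⟨U, hU, hzU, -⟩ := exists_isAffineOpen_mem_and_subset (Opens.mem_top z)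
  obtain ⟨I, hI, hcov⟩ := (isCompact_iff_finite_and_eq_biUnion_affineOpens (U := π ⁻¹ᵁ U)).1
    (QuasiCompact.isCompact_preimage (f := π) U.1 U.2 hU.isCompact)
  have := hI.fintype
  have hle (V : I) : V.1.1 ≤ π ⁻¹ᵁ U := hcov ▸ le_iSup₂_of_le V.1 V.2 le_rfl
  choose f hf H using fun V : I =>
    exists_notMem_length_fiber_add_le_pointDim π hU V.1.2 (hle V) z hzU
  obtain ⟨O, C, hO, hC, rfl⟩ := hZ
  have : JacobsonSpace S :=
    have := IsVariety.locallyOfFiniteType (X := S)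
    LocallyOfFiniteType.jacobsonSpace (S ↘ SpecC)
  -- Finitely many charts cover the preimage of U, so one function controls all of them.
  let F := ∏ V, f V
  have hF : F ∉ (hU.primeIdealOf ⟨z, hzU⟩).asIdeal := by
    rw [Ideal.IsPrime.prod_mem_iff]
    simpa using hf
  have hmem (t : S) (ht : t ∈ U) (g : Γ(S, U)) :
      t ∈ S.basicOpen g ↔ g ∉ (hU.primeIdealOf ⟨t, ht⟩).asIdeal := by
    rw [← S.evaluation_ne_zero_iff_mem_basicOpen t ht, ← ker_evaluation hU t ht]
    rfl
  -- S is Jacobson: a nonempty locally closed subset contains a closed point of S.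
  obtain ⟨t, ⟨⟨htO, htF⟩, hzt⟩, htc⟩ := nonempty_inter_closedPoints
    (Z := (O ∩ S.basicOpen F) ∩ closure {z}) ⟨z, ⟨hz.1, (hmem z hzU F).2 hF⟩, subset_closure rfl⟩
    ((hO.inter (S.basicOpen F).2).isLocallyClosed.inter isClosed_closure.isLocallyClosed)
  have hzt : z ⤳ t := specializes_iff_mem_closure.2 hzt
  have htU : t ∈ U := S.basicOpen_le F htF
  have htC : t ∈ C := hzt.mem_closed hC hz.2
  have hdim := hd t ⟨htO, htC⟩ htc
  rw [IsHomeomorph.topologicalKrullDim_eq _ (π.fiberHomeo t).isHomeomorph] at hdim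
  obtain ⟨l, hl⟩ := Order.le_krullDim_iff.1 hdim.ge
  obtain ⟨V, l', hl'⟩ := exists_ltSeries_primeSpectrum (Z := π ⁻¹' {t})
    (IsClosed.isLocallyClosed (htc.preimage π.continuous)) (V := fun V : I => V.1.1)
    (fun V => V.1.2) (fun y hy => by
      have hy : y ∈ π ⁻¹ᵁ U := by
        change π y ∈ U
        rwa [show π y = t from hy]
      rw [hcov] at hy
      simpa using hy) l
  obtain ⟨w, hw, hle⟩ := H V t htU hzt (fun h => (hmem t htU F).1 htF
    (Ideal.mem_of_dvd _ (Finset.dvd_prod_of_mem f (Finset.mem_univ V)) h)) l'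
  exact ⟨w, hw, by rwa [hl', hl] at hle⟩

end

end TrimMaps

/-! ### Dimension of varieties and bounds from the rank -/

namespace TrimMaps
open TopologicalSpace TensorProduct

section

variable {X : Scheme.{0}} [X.Over SpecC] [IsVariety X]

instance : IsIntegral X := IsVariety.isIntegral

theorem pointDim_le_pointDim_genericPoint (x : X) : pointDim X x ≤ pointDim X (genericPoint X) := by
  by_cases h : genericPoint X = x
  · rw [h]
  · exact (pointDim_lt_of_specializes (genericPoint_specializes x) h).le

theorem topologicalKrullDim_opens_eq_pointDim (W : X.Opens) [Nonempty W] :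
    topologicalKrullDim W = (pointDim X (genericPoint X) : WithBot ℕ∞) := by
  apply le_antisymm
  · refine iSup_le fun l => ?_
    obtain ⟨z, -, hz⟩ := exists_length_le_pointDim (Z := (W : Set X)) W.2.isLocallyClosed l
    exact_mod_cast hz.trans (pointDim_le_pointDim_genericPoint z)
  · obtain ⟨w⟩ := ‹Nonempty W›
    have hW : genericPoint X ∈ W := (genericPoint_specializes w.1).mem_open W.2 w.2
    obtain ⟨U, hU, hx, hUW⟩ := exists_isAffineOpen_mem_and_subset hW
    exact pointDim_le_topologicalKrullDim hU _ hx 1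
      ((Ideal.ne_top_iff_one _).1 (Ideal.IsPrime.ne_top inferInstance)) (W : Set X)
      fun p _ _ => hUW (fromSpec_mem hU p)

variable (X) in
theorem topologicalKrullDim_eq_pointDim :
    topologicalKrullDim X = (pointDim X (genericPoint X) : WithBot ℕ∞) := by
  have : Nonempty (⊤ : X.Opens) := ⟨⟨genericPoint X, trivial⟩⟩
  rw [← topologicalKrullDim_opens_eq_pointDim ⊤]
  exact (IsHomeomorph.topologicalKrullDim_eq _ (Homeomorph.Set.univ X).isHomeomorph).symm

end

section

variable {Y S : Scheme.{0}} [Y.Over SpecC] [S.Over SpecC] [IsVariety Y] [IsVariety S] (π : Y ⟶ S)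
  [π.IsOver SpecC]

/-- Here c is the dimension of κ(y) ⊗ Ω_{Y/S}, the corank of the differential. The bounds come from
rank-nullity and smoothness, from the residue field extension κ(y)/κ(π y), and from generic
constancy of the rank on the closure of y. -/
theorem exists_differentialRank_bounds (hY : IsNonsingular Y) (y : Y) :
    ∃ c : ℕ, differentialRank π y + c ≤ pointDim Y (genericPoint Y) ∧
      pointDim Y y ≤ pointDim S (π y) + c ∧
      (pointDim Y y : WithBot ℕ∞) ≤ topologicalKrullDim (rankLocus π (differentialRank π y)) := by
  obtain ⟨U, hU, hyU, -⟩ := exists_isAffineOpen_mem_and_subset (Opens.mem_top (π y))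
  obtain ⟨V, hV, hy, e⟩ := exists_isAffineOpen_mem_and_subset (U := π ⁻¹ᵁ U) (x := y) hyU
  replace e : V ≤ π ⁻¹ᵁ U := e
  algebraize [(π.appLE U V e).hom]
  have : IsScalarTower ℂ Γ(S, U) Γ(Y, V) :=
    .of_algebraMap_eq' (appLE_comp_sectionStructureHom π e).symm
  have := finiteType_section hU
  have := finiteType_section hV
  have := smooth_section hY hV
  have : Nonempty V := ⟨⟨y, hy⟩⟩
  have : IsDomain Γ(Y, V) := inferInstance
  have : Algebra.FiniteType Γ(S, U) Γ(Y, V) := .of_restrictScalars_finiteType ℂ _ _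
  have : IsNoetherianRing Γ(Y, V) := Algebra.FiniteType.isNoetherianRing ℂ _
  let P := hV.primeIdealOf ⟨y, hy⟩
  have hrank := differentialRank_add_finrank π hU hV e y hy
  refine ⟨Module.finrank P.asIdeal.ResidueField (P.asIdeal.Fiber Ω[Γ(Y, V)⁄Γ(S, U)]), ?_, ?_, ?_⟩
  · have h1 := finrank_fiber_kaehlerDifferential_le (k := ℂ) P.asIdeal
    rw [← hrank] at h1
    have h2 := h1.trans ((PrimeSpectrum.topologicalKrullDim_eq_ringKrullDim _).ge.trans
      (hV.fromSpec.isOpenEmbedding.isInducing.topologicalKrullDim_le.trans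
      (topologicalKrullDim_eq_pointDim Y).le))
    exact_mod_cast h2
  · have h1 := ringKrullDim_quotient_le_add_finrank ℂ (hU.primeIdealOf ⟨π y, hyU⟩).asIdeal P.asIdeal
      (congrArg PrimeSpectrum.asIdeal (IsAffineOpen.comap_primeIdealOf_appLE U hU V hV e hy))
    rw [ringKrullDim_quotient_primeIdealOf, ringKrullDim_quotient_primeIdealOf] at h1
    exact_mod_cast h1
  · obtain ⟨f, hf, Hf⟩ := exists_notMem_finrank_fiber_eq (M := Ω[Γ(Y, V)⁄Γ(S, U)]) P.asIdeal
    obtain ⟨g, hg, Hg⟩ := exists_notMem_finrank_fiber_eq (M := Ω[Γ(Y, V)⁄ℂ]) P.asIdeal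
    -- Off the zeros of f and g the fiber ranks of Ω_{Y/S} and Ω_Y are both constant on the closure
    -- of y, hence so is their difference, the rank of dπ.
    refine pointDim_le_topologicalKrullDim hV y hy (f * g)
      (fun h => (Ideal.IsPrime.mem_or_mem inferInstance h).elim hf hg) _ fun p hp hfg => ?_
    have h1 := differentialRank_add_finrank π hU hV e (hV.fromSpec p) (fromSpec_mem hV p)
    rw [primeIdealOf_fromSpec] at h1
    have h2 := Hf p.asIdeal hp fun h => hfg (Ideal.mul_mem_right _ _ h)
    have h3 := Hg p.asIdeal hp fun h => hfg (Ideal.mul_mem_left _ _ h)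
    change differentialRank π _ = differentialRank π y
    refine Nat.add_right_cancel (hrank.trans ?_ : _ = differentialRank π _ + _) |>.symm
    refine h3.symm.trans (h1.symm.trans (congrArg _ h2))

end

end TrimMaps

/-! ### Birational maps and the smallness inequality -/

namespace TrimMaps
open TopologicalSpace

theorem IsBirational.target_subset_range {Y S : Scheme.{0}} {π : Y ⟶ S}
    {f : Scheme.PartialIso Y S}
    (hf : f.iso.hom ≫ f.target.ι = f.source.ι ≫ π) : (f.target : Set S) ⊆ Set.range π := by
  intro s hs
  have h : f.iso.inv ≫ f.source.ι ≫ π = f.target.ι := by rw [← hf, Iso.inv_hom_id_assoc]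
  refine ⟨f.source.ι (f.iso.inv ⟨s, hs⟩), ?_⟩
  change (f.iso.inv ≫ f.source.ι ≫ π) ⟨s, hs⟩ = s
  rw [h]
  rfl

theorem IsBirational.surjective {Y S : Scheme.{0}} {π : Y ⟶ S} [IsProper π] (h : IsBirational π) :
    Function.Surjective π := by
  obtain ⟨f, hf⟩ := h
  rw [← Set.range_eq_univ, ← π.isClosedMap.isClosed_range.closure_eq]
  exact (f.dense_target.mono (target_subset_range hf)).closure_eq

section

variable {Y S : Scheme.{0}} [Y.Over SpecC] [S.Over SpecC] [IsVariety Y] [IsVariety S]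

/-- A nonempty open subset of a variety has full dimension, because it contains the generic point.
-/
theorem IsBirational.topologicalKrullDim_eq {π : Y ⟶ S} (h : IsBirational π) :
    topologicalKrullDim Y = topologicalKrullDim S := by
  obtain ⟨f, hf⟩ := h
  have : Nonempty f.source := f.dense_source.nonempty.to_subtype
  have : Nonempty f.target := f.dense_target.nonempty.to_subtype
  rw [topologicalKrullDim_eq_pointDim, topologicalKrullDim_eq_pointDim,
    ← topologicalKrullDim_opens_eq_pointDim f.source,
    ← topologicalKrullDim_opens_eq_pointDim f.target]
  exact IsHomeomorph.topologicalKrullDim_eq _ f.iso.hom.homeomorph.isHomeomorph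

theorem pointDim_lt_of_not_dense {X : Scheme.{0}} [X.Over SpecC] [IsVariety X] {Z : Set X}
    (hZ : ¬ Dense Z) {z : X} (hz : z ∈ Z) : pointDim X z < pointDim X (genericPoint X) := by
  refine pointDim_lt_of_specializes (genericPoint_specializes z) ?_
  rintro rfl
  refine hZ (Dense.mono (Set.singleton_subset_iff.2 hz) ?_)
  rw [dense_iff_closure_eq]
  exact genericPoint_closure X

theorem IsTrim.twiceLtCodim {π : Y ⟶ S} [π.IsOver SpecC] [IsProper π] (htrim : IsTrim π)
    (hY : IsNonsingular Y) (hdim : topologicalKrullDim Y = topologicalKrullDim S) {Z : Set S}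
    {d : ℕ} (hne : Z.Nonempty) (hZ : IsLocallyClosed Z) (hnd : ¬ Dense Z)
    (hd : HasFiberDim π Z d) : TwiceLtCodim d Z := by
  have key (z : S) (hz : z ∈ Z) : pointDim S z + 2 * d < pointDim S (genericPoint S) := by
    obtain ⟨y, rfl, hy⟩ := exists_pointDim_add_le_of_hasFiberDim π hZ hd hz
    obtain ⟨c, h1, h2, h3⟩ := exists_differentialRank_bounds π hY y
    have h4 := pointDim_lt_of_not_dense hnd hz
    rw [topologicalKrullDim_eq_pointDim, topologicalKrullDim_eq_pointDim] at hdim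
    have hdim : pointDim Y (genericPoint Y) = pointDim S (genericPoint S) := by exact_mod_cast hdim
    by_cases hr : differentialRank π y < pointDim Y (genericPoint Y)
    · have h5 := h3.trans_lt (htrim _ (by
        rw [topologicalKrullDim_eq_pointDim]; exact_mod_cast hr))
      have h6 : pointDim Y y < differentialRank π y := by exact_mod_cast h5
      omega
    -- Full rank forces c = 0 and hence d = 0; strictness comes from the non-density of Z.
    · omega
  have hle : topologicalKrullDim Z ≤
      ((pointDim S (genericPoint S) - 2 * d - 1 : ℕ) : WithBot ℕ∞) := by
    refine iSup_le fun l => ?_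
    obtain ⟨z, hz, hlz⟩ := exists_length_le_pointDim hZ l
    have := key z hz
    have h : l.length ≤ pointDim S (genericPoint S) - 2 * d - 1 := by omega
    exact_mod_cast h
  -- A point of Z shows that 2d < dim S, so the truncated subtraction in `hle` is exact.
  obtain ⟨z, hz⟩ := hne
  have := key z hz
  refine (add_le_add_right hle _).trans_lt ?_
  rw [topologicalKrullDim_eq_pointDim]
  have h : 2 * d + (pointDim S (genericPoint S) - 2 * d - 1) < pointDim S (genericPoint S) := by
    omega
  exact_mod_cast h

end

end TrimMaps

/-- A trim proper birational morphism `π : Y ⟶ S` of complex varieties, with `Y` nonsingular, is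
small. The inequality `2 d(Z) < codim_S Z` holds moreover for every nonempty non-dense locally
closed `Z` along which the dimension of the fibers is constant, whether or not it is given
as a stratum of a stratification. -/
theorem mainTheorem3 (Y S : Scheme.{0}) [Y.Over TrimMaps.SpecC] [S.Over TrimMaps.SpecC]
    [TrimMaps.IsVariety Y] [TrimMaps.IsVariety S] (π : Y ⟶ S) [π.IsOver TrimMaps.SpecC]
    (hY : TrimMaps.IsNonsingular Y) (hproper : IsProper π) (hbir : TrimMaps.IsBirational π)
    (htrim : TrimMaps.IsTrim π) :
    TrimMaps.IsSmall π ∧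
      ∀ (Z : Set S) (d : ℕ), Z.Nonempty → IsLocallyClosed Z → ¬ Dense Z →
        TrimMaps.HasFiberDim π Z d → TrimMaps.TwiceLtCodim d Z := by
  have h (Z : Set S) (d : ℕ) (hne : Z.Nonempty) (hZ : IsLocallyClosed Z) (hnd : ¬ Dense Z)
      (hd : TrimMaps.HasFiberDim π Z d) : TrimMaps.TwiceLtCodim d Z :=
    htrim.twiceLtCodim hY hbir.topologicalKrullDim_eq hne hZ hnd hd
  exact ⟨⟨hproper, hbir.surjective, hbir.topologicalKrullDim_eq, fun 𝒮 _ Z hZ hnd d hd =>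
    h Z d (𝒮.nonempty Z hZ) (𝒮.isLocallyClosed Z hZ) hnd hd⟩, h⟩
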